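/- An interval sequence of length $n$ is a sequence $S=([a_1,b_1],\dots,[a_n,b_n])$ of integer intervals with $0\le a_i\le b_i\le n-1$ for all $i$; write $A=(a_1,\dots,a_n)$ and $B=(b_1,\dots,b_n)$. A sequence $D=(d_1,\dots,d_n)$ of non-negative integers is graphic if it is the degree sequence of a simple graph on $n$ vertices $1,\dots,n$. A graphic sequence $D$ with $A\le D\le B$ entrywise is a certificate of $S$; $S$ is realizable if it has a certificate, and a graph realizes $S$ if its degree sequence is a certificate of $S$. There is an algorithm (one program for a unit-cost random access machine with words of $O(\log n)$ bits) that, for every integer $n\ge 1$ and every interval sequence $S$ of length $n$, halts after $O(n\log n)$ steps (as $n\to\infty$, uniformly over all $S$ of length $n$), decides whether $S$ is realizable, and, if it is, outputs a certificate $D$ of $S$. Moreover, for realizable $S$ it also outputs, within the same time bound, the degree sequence of a sparsest graph realizing $S$ (one with the minimum number of edges among all graphs realizing $S$) and the degree sequence of a densest graph realizing $S$ (one with the maximum number of edges among all graphs realizing $S$). -/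

import Mathlib

/-! ### Graphic sequences and interval sequences -/

open Classical in
/-- The degree sequence of a simple graph on the vertex set `Fin n`. -/
noncomputable def degreeSeq {n : ℕ} (G : SimpleGraph (Fin n)) : Fin n → ℕ :=
  fun i => G.degree i

/-- A sequence of `n` natural numbers is graphic if it is the degree sequence of
a simple graph on `n` vertices. -/
def IsGraphic {n : ℕ} (D : Fin n → ℕ) : Prop :=
  ∃ G : SimpleGraph (Fin n), degreeSeq G = D

/-- An interval sequence of length `n`: intervals `[a_i, b_i]` with
`0 ≤ a_i ≤ b_i ≤ n - 1`. -/
structure IntervalSeq (n : ℕ) where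
  /-- the lower ends `A` -/
  lower : Fin n → ℕ
  /-- the upper ends `B` -/
  upper : Fin n → ℕ
  lower_le_upper : ∀ i, lower i ≤ upper i
  upper_lt : ∀ i, upper i < n

namespace IntervalSeq

variable {n : ℕ}

/-- `D` lies in the interval sequence `(A, B)`, that is `A ≤ D ≤ B` entrywise. -/
def Contains (S : IntervalSeq n) (D : Fin n → ℕ) : Prop :=
  ∀ i, S.lower i ≤ D i ∧ D i ≤ S.upper i

/-- `D` is a graphic certificate: a graphic sequence lying in the interval sequence. -/
def IsCertificate (S : IntervalSeq n) (D : Fin n → ℕ) : Prop :=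
  IsGraphic D ∧ S.Contains D

/-- The interval sequence is realizable: it has a graphic certificate. -/
def Realizable (S : IntervalSeq n) : Prop :=
  ∃ D : Fin n → ℕ, S.IsCertificate D

/-- The graph `G` realizes the interval sequence. -/
def RealizedBy (S : IntervalSeq n) (G : SimpleGraph (Fin n)) : Prop :=
  S.Contains (degreeSeq G)

/-- `D` is the degree sequence of a realizing graph with the fewest edges among all
realizing graphs. -/
def IsSparsestCertificate (S : IntervalSeq n) (D : Fin n → ℕ) : Prop :=
  ∃ G : SimpleGraph (Fin n), degreeSeq G = D ∧ S.RealizedBy G ∧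
    ∀ H : SimpleGraph (Fin n), S.RealizedBy H → G.edgeSet.ncard ≤ H.edgeSet.ncard

/-- `D` is the degree sequence of a realizing graph with the most edges among all
realizing graphs. -/
def IsDensestCertificate (S : IntervalSeq n) (D : Fin n → ℕ) : Prop :=
  ∃ G : SimpleGraph (Fin n), degreeSeq G = D ∧ S.RealizedBy G ∧
    ∀ H : SimpleGraph (Fin n), S.RealizedBy H → H.edgeSet.ncard ≤ G.edgeSet.ncard

end IntervalSeq

/-! ### A word RAM with structured programs and a step count

A machine has registers and random-access arrays, all holding natural numbers. A program
is a finite text, so it mentions only finitely many registers, arrays and constants.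
Every elementary instruction and every evaluation of a test costs one step. The semantics is
relative to a word bound `W`: an instruction whose result is not below `W` has no
execution, so the machine works throughout with words of `log₂ W` bits. -/

namespace RAM

/-- The arithmetic instructions: addition, truncated subtraction, multiplication and
division rounded down. -/
inductive Op
  | add
  | sub
  | mul
  | div

/-- The value of an arithmetic instruction. -/
def Op.eval : Op → ℕ → ℕ → ℕ
  | .add, x, y => x + y
  | .sub, x, y => x - y
  | .mul, x, y => x * y
  | .div, x, y => x / y

/-- The comparisons of two registers. -/
inductive Test
  | eq
  | lt

/-- When a comparison succeeds. -/
def Test.Holds : Test → ℕ → ℕ → Prop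
  | .eq, x, y => x = y
  | .lt, x, y => x < y

/-- Programs. Registers and arrays are named by natural numbers. -/
inductive Prog
  /-- do nothing -/
  | skip
  /-- `reg r := c` -/
  | const (r c : ℕ)
  /-- `reg r := reg s` -/
  | copy (r s : ℕ)
  /-- `reg r := reg s ∘ reg t` for an arithmetic instruction `∘` -/
  | arith (o : Op) (r s t : ℕ)
  /-- `reg r := arr a [reg s]` -/
  | load (r a s : ℕ)
  /-- `arr a [reg s] := reg r` -/
  | store (a s r : ℕ)
  /-- first `p`, then `q` -/
  | seq (p q : Prog)
  /-- if the test of `reg s` against `reg t` holds then `p`, else `q` -/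
  | cond (b : Test) (s t : ℕ) (p q : Prog)
  /-- while the test of `reg s` against `reg t` holds, do `p` -/
  | loop (b : Test) (s t : ℕ) (p : Prog)

/-- A memory state: the contents of the registers and of the arrays. -/
structure State where
  /-- the contents of the registers -/
  reg : ℕ → ℕ
  /-- `arr a i` is the entry with index `i` of the array `a` -/
  arr : ℕ → ℕ → ℕ

/-- Overwrite one register. -/
def State.setReg (σ : State) (r v : ℕ) : State :=
  { σ with reg := Function.update σ.reg r v }

/-- Overwrite one array entry. -/
def State.setArr (σ : State) (a i v : ℕ) : State :=
  { σ with arr := Function.update σ.arr a (Function.update (σ.arr a) i v) }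

/-- `Exec W p σ k τ`: started in the state `σ`, the program `p` halts after exactly `k` steps
in the state `τ`, and no computed value reaches the word bound `W`. -/
inductive Exec (W : ℕ) : Prog → State → ℕ → State → Prop
  | skip (σ : State) : Exec W .skip σ 1 σ
  | const (σ : State) (r c : ℕ) (h : c < W) : Exec W (.const r c) σ 1 (σ.setReg r c)
  | copy (σ : State) (r s : ℕ) : Exec W (.copy r s) σ 1 (σ.setReg r (σ.reg s))
  | arith (σ : State) (o : Op) (r s t : ℕ) (h : o.eval (σ.reg s) (σ.reg t) < W) :
      Exec W (.arith o r s t) σ 1 (σ.setReg r (o.eval (σ.reg s) (σ.reg t)))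
  | load (σ : State) (r a s : ℕ) :
      Exec W (.load r a s) σ 1 (σ.setReg r (σ.arr a (σ.reg s)))
  | store (σ : State) (a s r : ℕ) :
      Exec W (.store a s r) σ 1 (σ.setArr a (σ.reg s) (σ.reg r))
  | seq {p q : Prog} {σ τ υ : State} {k l : ℕ} (hp : Exec W p σ k τ) (hq : Exec W q τ l υ) :
      Exec W (.seq p q) σ (k + l) υ
  | cond_true {b : Test} {s t : ℕ} {p q : Prog} {σ τ : State} {k : ℕ}
      (hb : b.Holds (σ.reg s) (σ.reg t)) (hp : Exec W p σ k τ) :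
      Exec W (.cond b s t p q) σ (1 + k) τ
  | cond_false {b : Test} {s t : ℕ} {p q : Prog} {σ τ : State} {k : ℕ}
      (hb : ¬ b.Holds (σ.reg s) (σ.reg t)) (hq : Exec W q σ k τ) :
      Exec W (.cond b s t p q) σ (1 + k) τ
  | loop_true {b : Test} {s t : ℕ} {p : Prog} {σ τ υ : State} {k l : ℕ}
      (hb : b.Holds (σ.reg s) (σ.reg t)) (hp : Exec W p σ k τ)
      (hl : Exec W (.loop b s t p) τ l υ) :
      Exec W (.loop b s t p) σ (1 + k + l) υ
  | loop_false {b : Test} {s t : ℕ} {p : Prog} {σ : State}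
      (hb : ¬ b.Holds (σ.reg s) (σ.reg t)) :
      Exec W (.loop b s t p) σ 1 σ

/-- The machine is deterministic: step count and final state are functions of the program
and the initial state. -/
theorem Exec.deterministic {W : ℕ} {p : Prog} {σ τ τ' : State} {k k' : ℕ}
    (h : Exec W p σ k τ) (h' : Exec W p σ k' τ') : k = k' ∧ τ = τ' := by
  induction h generalizing k' τ' with
  | skip | const | copy | arith | load | store => cases h'; exact ⟨rfl, rfl⟩
  | seq hp hq ihp ihq =>
    cases h' with
    | seq hp' hq' =>
      obtain ⟨rfl, rfl⟩ := ihp hp'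
      obtain ⟨rfl, rfl⟩ := ihq hq'
      exact ⟨rfl, rfl⟩
  | cond_true hb hp ih =>
    cases h' with
    | cond_true _ hp' => obtain ⟨rfl, rfl⟩ := ih hp'; exact ⟨rfl, rfl⟩
    | cond_false hb' _ => exact absurd hb hb'
  | cond_false hb hq ih =>
    cases h' with
    | cond_true hb' _ => exact absurd hb' hb
    | cond_false _ hq' => obtain ⟨rfl, rfl⟩ := ih hq'; exact ⟨rfl, rfl⟩
  | loop_true hb hp hl ihp ihl =>
    cases h' with
    | loop_true _ hp' hl' =>
      obtain ⟨rfl, rfl⟩ := ihp hp'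
      obtain ⟨rfl, rfl⟩ := ihl hl'
      exact ⟨rfl, rfl⟩
    | loop_false hb' => exact absurd hb hb'
  | loop_false hb =>
    cases h' with
    | loop_true hb' _ _ => exact absurd hb' hb
    | loop_false _ => exact ⟨rfl, rfl⟩

/-- The initial state for an interval sequence of length `n`: register `0` holds `n`, array
`0` holds the lower ends, array `1` holds the upper ends, and all else is `0`. -/
def input {n : ℕ} (S : IntervalSeq n) : State where
  reg r := if r = 0 then n else 0
  arr a i :=
    if h : i < n then
      if a = 0 then S.lower ⟨i, h⟩ else if a = 1 then S.upper ⟨i, h⟩ else 0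
    else 0

/-- The first `n` entries of the array `a`. -/
def State.read (σ : State) (n a : ℕ) : Fin n → ℕ :=
  fun i => σ.arr a i

end RAM

/-! A sequence with even sum is graphic iff no pair `X ⊆ W` of vertex sets has an `excess` above
that sum (`isGraphic_iff`). The excess is monotone in the sequence, so the largest excess of the
lower bounds, rounded up to an even number, bounds the degree sum of every certificate from below
(`IntervalSeq.IsCertificate.le_sum`).

For a realizable interval sequence this bound is attained. Raise a common height, clamped entrywise
between the two bounds, with one entry at a time moving up, until the sum is the target. For some
`L`, every entry at or above `L + 2` is then at its lower bound and every entry below `L` at its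
upper bound. If a pair overloads this sequence, it can be exchanged for an overloaded pair that is
separated from the levels `L` and `L + 1` (`EG.exists_split`). On such a pair the levelled sequence
can be compared with the lower bounds or with an arbitrary certificate, and both comparisons are
contradictory (`EG.feasible_of_levelled`). So realizability is decided by testing one levelled
sequence, and that sequence is a sparsest certificate. Complementing the graphs and the intervals
turns sparsest into densest.

For the running time, the largest excess occurs at threshold sets (`EG.exists_threshold`), hence it
is found in linear time from suffix sums of value counts. The height is one of `n * n + 1` numbers
and is found by bisection, each probe costing linear time; this gives the factor `log n`. -/

/-! ### The Erdős–Gallai theorem -/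

namespace EG

open Finset

variable {V : Type*} [Fintype V]

open Classical in
/-- The neighbours of a vertex, as a finite set. -/
noncomputable def nbrs (G : SimpleGraph V) (v : V) : Finset V := univ.filter (G.Adj v)

/-- The degree of a vertex. -/
noncomputable def deg (G : SimpleGraph V) (v : V) : ℕ := (nbrs G v).card

@[simp] theorem mem_nbrs {G : SimpleGraph V} {v w : V} : w ∈ nbrs G v ↔ G.Adj v w := by
  simp [nbrs]

theorem deg_eq_degree (G : SimpleGraph V) (v : V) [Fintype (G.neighborSet v)] :
    deg G v = G.degree v := by
  rw [deg, ← SimpleGraph.card_neighborFinset_eq_degree]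
  congr 1
  ext w
  simp

theorem even_sum_deg (G : SimpleGraph V) : Even (∑ v, deg G v) := by
  classical
  simp_rw [deg_eq_degree]
  rw [SimpleGraph.sum_degrees_eq_twice_card_edges]
  exact even_two_mul _

variable [DecidableEq V]

theorem deg_sup_edge {G : SimpleGraph V} {u v : V} (huv : u ≠ v) (h : ¬ G.Adj u v) (w : V) :
    deg (G ⊔ SimpleGraph.edge u v) w =
      deg G w + (if w = u then 1 else 0) + (if w = v then 1 else 0) := by
  by_cases hu : w = u
  · subst hu
    have : nbrs (G ⊔ SimpleGraph.edge w v) w = insert v (nbrs G w) := by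
      ext x
      simp [SimpleGraph.edge_adj]
      grind
    rw [deg, this, card_insert_of_notMem (by simpa using h)]
    simp [deg, huv]
  · by_cases hv : w = v
    · subst hv
      have : nbrs (G ⊔ SimpleGraph.edge u w) w = insert u (nbrs G w) := by
        ext x
        simp [SimpleGraph.edge_adj]
        grind
      rw [deg, this, card_insert_of_notMem (by simpa using fun h' => h h'.symm)]
      simp [deg, huv.symm]
    · have : nbrs (G ⊔ SimpleGraph.edge u v) w = nbrs G w := by
        ext x
        simp [SimpleGraph.edge_adj]
        grind
      rw [deg, this]
      simp [deg, hu, hv]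

theorem deg_sdiff_edge {G : SimpleGraph V} {u v : V} (h : G.Adj u v) (w : V) :
    deg (G \ SimpleGraph.edge u v) w + (if w = u then 1 else 0) + (if w = v then 1 else 0) =
      deg G w := by
  have huv := h.ne
  rw [← deg_sup_edge huv (by simp [SimpleGraph.edge_adj, huv])]
  congr 1
  rw [sdiff_sup_cancel]
  rw [SimpleGraph.edge_le_iff]
  exact Or.inr h

/-- Otherwise the neighbours of `i` would inject into those of `r`, with `r` and `i` exchanged if
the two are adjacent. This supplies the vertex `u` of all the edge exchanges below. -/
theorem exists_private_nbr {G : SimpleGraph V} {i r : V} (h : deg G r < deg G i) :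
    ∃ u, G.Adj i u ∧ ¬ G.Adj r u ∧ u ≠ r := by
  classical
  by_contra! hc
  have hsub : nbrs G i ⊆ if G.Adj i r then insert r ((nbrs G r).erase i) else nbrs G r := by
    intro u hu
    rw [mem_nbrs] at hu
    have := hc u hu
    have := hu.ne
    split_ifs <;> simp <;> grind
  have := card_le_card hsub
  split_ifs at this with hir
  · have h2 := card_insert_le r ((nbrs G r).erase i)
    rw [card_erase_of_mem (by simpa using hir.symm)] at h2
    have : 0 < (nbrs G r).card := card_pos.2 ⟨i, by simpa using hir.symm⟩
    simp only [deg] at h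
    omega
  · exact absurd h (not_lt.2 this)

/-- A graph with degrees at most `d`, with equality on `P`, in which the vertices outside
`P ∪ {r}` are independent. -/
structure Sub (d : V → ℕ) (P : Finset V) (r : V) (G : SimpleGraph V) : Prop where
  le : ∀ v, deg G v ≤ d v
  full : ∀ v ∈ P, deg G v = d v
  indep : ∀ u v, u ∉ P → u ≠ r → v ∉ P → v ≠ r → ¬ G.Adj u v

/-! ### Edge exchanges that raise the degree of one vertex. -/

variable {d : V → ℕ} {P : Finset V} {r : V} {G : SimpleGraph V}


/-- Parity: if `r` were the only deficient vertex, lacking exactly one, the sum of `d` would exceed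
the even degree sum by one. -/
theorem Sub.exists_deficient (hG : Sub d P r G) (hr : deg G r + 1 = d r)
    (heven : Even (∑ v, d v)) : ∃ k, k ∉ P ∧ k ≠ r ∧ deg G k < d k := by
  by_contra! hc
  have h1 : ∀ v, d v = deg G v + if v = r then 1 else 0 := by
    intro v
    by_cases hv : v = r
    · subst hv; simp [hr]
    · by_cases hP : v ∈ P
      · simp [hv, hG.full v hP]
      · have := hc v hP hv
        have := hG.le v
        simp [hv]; omega
  have h2 : ∑ v, d v = (∑ v, deg G v) + 1 := by
    rw [sum_congr rfl fun v _ => h1 v, sum_add_distrib]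
    simp
  have h3 := even_sum_deg G
  rw [h2] at heven
  rw [Nat.even_add_one] at heven
  exact heven h3

theorem Sub.improve_edge (hG : Sub d P r G) {s : V} (hsr : s ≠ r) (hs : ¬ G.Adj r s)
    (hds : deg G s < d s) (hr : deg G r < d r) (hsP : s ∉ P) (hrP : r ∉ P) :
    ∃ G', Sub d P r G' ∧ deg G r < deg G' r := by
  have hd := deg_sup_edge hsr.symm hs
  refine ⟨G ⊔ SimpleGraph.edge r s, ⟨fun v => ?_, fun v hv => ?_, fun u v hu hur hv hvr => ?_⟩, ?_⟩
  · have := hG.le v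
    rw [hd]
    split_ifs <;> grind
  · have := hG.full v hv
    rw [hd]
    split_ifs <;> grind
  · have := hG.indep u v hu hur hv hvr
    simp [SimpleGraph.edge_adj]
    grind
  · rw [hd]; simp only [if_true]; omega

/-- The exchange of `iu` for `ru` and `ri` keeps the degrees of `i` and `u` and gives `r` two more.
If `r` has room for only one, the edge from `r` to another deficient vertex is given up. -/
theorem Sub.improve_nonadj_full (hG : Sub d P r G) (hr : deg G r < d r) (hrP : r ∉ P)
    (heven : Even (∑ v, d v)) (hmax : ∀ v ∈ P, d r ≤ d v)
    (h0 : ∀ s, s ∉ P → s ≠ r → deg G s < d s → G.Adj r s) {i : V} (hi : i ∈ P)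
    (hri : ¬ G.Adj r i) : ∃ G', Sub d P r G' ∧ deg G r < deg G' r := by
  have hir : i ≠ r := fun h => hrP (h ▸ hi)
  obtain ⟨u, hiu, hru, hur⟩ := exists_private_nbr (i := i) (r := r) (G := G)
    (by have := hG.full i hi; have := hmax i hi; omega)
  have hui : u ≠ i := hiu.ne.symm
  -- replace the edge `iu` by `ru` and `ri`
  have e1 := deg_sdiff_edge hiu
  set G1 := G \ SimpleGraph.edge i u with hG1
  have e2 := deg_sup_edge (G := G1) hur.symm (by simp [hG1, hru])
  set G2 := G1 ⊔ SimpleGraph.edge r u with hG2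
  have e3 := deg_sup_edge (G := G2) hir.symm
    (by simp [hG2, hG1, hri, SimpleGraph.edge_adj, hir, hui.symm])
  set G3 := G2 ⊔ SimpleGraph.edge r i with hG3
  have hd3 : ∀ v, deg G3 v = deg G v + if v = r then 2 else 0 := by
    intro v
    have := e1 v
    have := e2 v
    have := e3 v
    split_ifs at * <;> grind
  have hindep : ∀ u v, u ∉ P → u ≠ r → v ∉ P → v ≠ r → ¬ G3.Adj u v := by
    intro x y hx hxr hy hyr
    have := hG.indep x y hx hxr hy hyr
    simp [hG3, hG2, hG1, SimpleGraph.edge_adj]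
    grind
  by_cases h2 : deg G r + 2 ≤ d r
  · refine ⟨G3, ⟨fun v => ?_, fun v hv => ?_, hindep⟩, by simp [hd3]⟩
    · have := hG.le v
      rw [hd3]; split_ifs <;> grind
    · have := hG.full v hv
      rw [hd3]; split_ifs <;> grind
  · obtain ⟨k, hkP, hkr, hk⟩ := hG.exists_deficient (by omega) heven
    have hrk := h0 k hkP hkr hk
    have e4 := deg_sdiff_edge (G := G3) (u := r) (v := k)
      (by
        have : k ≠ i := fun h => hkP (h ▸ hi)
        simp [hG3, hG2, hG1, SimpleGraph.edge_adj]
        grind)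
    set G4 := G3 \ SimpleGraph.edge r k with hG4
    have hd4 : ∀ v, deg G4 v + (if v = k then 1 else 0) = deg G v + if v = r then 1 else 0 := by
      intro v
      have := e4 v
      have := hd3 v
      split_ifs at * <;> grind
    refine ⟨G4, ⟨fun v => ?_, fun v hv => ?_, fun x y hx hxr hy hyr h => ?_⟩, ?_⟩
    · have := hG.le v
      have := hd4 v
      split_ifs at * <;> grind
    · have := hG.full v hv
      have := hd4 v
      split_ifs at * <;> grind
    · exact hindep x y hx hxr hy hyr (by simp [hG4] at h; exact h.1)
    · have := hd4 r
      simp [hkr.symm] at this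
      omega

/-- Having at most `P.card` neighbours, among them `r`, the vertex `k` misses some `i ∈ P`.
Exchanging `iu` for `ru` and `ik` then raises only `r` and `k`, which are both deficient. -/
theorem Sub.improve_low (hG : Sub d P r G) (hr : deg G r < d r) (hrP : r ∉ P)
    (hmax : ∀ v ∈ P, d r ≤ d v)
    (h1 : ∀ i ∈ P, G.Adj r i) {k : V} (hkP : k ∉ P) (hkr : k ≠ r) (hrk : G.Adj r k)
    (hk : deg G k < d k) (hkc : deg G k < P.card + 1) :
    ∃ G', Sub d P r G' ∧ deg G r < deg G' r := by
  obtain ⟨i, hi, hki⟩ : ∃ i ∈ P, ¬ G.Adj k i := by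
    by_contra! hc
    have : insert r P ⊆ nbrs G k := by
      intro x hx
      rw [mem_insert] at hx
      rw [mem_nbrs]
      rcases hx with rfl | hx
      · exact hrk.symm
      · exact hc x hx
    have := card_le_card this
    rw [card_insert_of_notMem hrP] at this
    simp only [deg] at hkc
    omega
  have hir : i ≠ r := fun h => hrP (h ▸ hi)
  have hik : i ≠ k := fun h => hkP (h ▸ hi)
  obtain ⟨u, hiu, hru, hur⟩ := exists_private_nbr (i := i) (r := r) (G := G)
    (by have := hG.full i hi; have := hmax i hi; omega)
  have hui : u ≠ i := hiu.ne.symm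
  have huk : u ≠ k := fun h => hru (h ▸ hrk)
  have e1 := deg_sdiff_edge hiu
  set G1 := G \ SimpleGraph.edge i u with hG1
  have e2 := deg_sup_edge (G := G1) hur.symm (by simp [hG1, hru])
  set G2 := G1 ⊔ SimpleGraph.edge r u with hG2
  have e3 := deg_sup_edge (G := G2) hik
    (by
      have := fun h : G.Adj i k => hki h.symm
      simp [hG2, hG1, SimpleGraph.edge_adj]
      grind)
  set G3 := G2 ⊔ SimpleGraph.edge i k with hG3
  have hd3 : ∀ v, deg G3 v = deg G v + (if v = r then 1 else 0) + if v = k then 1 else 0 := by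
    intro v
    have := e1 v
    have := e2 v
    have := e3 v
    split_ifs at * <;> grind
  refine ⟨G3, ⟨fun v => ?_, fun v hv => ?_, fun x y hx hxr hy hyr => ?_⟩, ?_⟩
  · have := hG.le v
    rw [hd3]; split_ifs <;> grind
  · have := hG.full v hv
    rw [hd3]; split_ifs <;> grind
  · have := hG.indep x y hx hxr hy hyr
    simp [hG3, hG2, hG1, SimpleGraph.edge_adj]
    grind
  · rw [hd3]; simp; omega

/-- The edges `iu` and `jw` are exchanged for `ij` and `ru`. Only `w` loses a degree, which is
allowed: `r` is adjacent to all of `P`, so `w` lies outside `P`. The vertices `u` and `w` may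
coincide. -/
theorem Sub.improve_nonclique (hG : Sub d P r G) (hr : deg G r < d r) (hrP : r ∉ P)
    (hmax : ∀ v ∈ P, d r ≤ d v) (h1 : ∀ i ∈ P, G.Adj r i) {i j : V} (hi : i ∈ P) (hj : j ∈ P)
    (hij : i ≠ j) (hnij : ¬ G.Adj i j) : ∃ G', Sub d P r G' ∧ deg G r < deg G' r := by
  have hir : i ≠ r := fun h => hrP (h ▸ hi)
  have hjr : j ≠ r := fun h => hrP (h ▸ hj)
  obtain ⟨u, hiu, hru, hur⟩ := exists_private_nbr (i := i) (r := r) (G := G)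
    (by have := hG.full i hi; have := hmax i hi; omega)
  obtain ⟨w, hjw, hrw, hwr⟩ := exists_private_nbr (i := j) (r := r) (G := G)
    (by have := hG.full j hj; have := hmax j hj; omega)
  have huP : u ∉ P := fun h => hru (h1 u h)
  have hwP : w ∉ P := fun h => hrw (h1 w h)
  have e1 := deg_sdiff_edge hiu
  set G1 := G \ SimpleGraph.edge i u with hG1
  have e2 := deg_sdiff_edge (G := G1) (u := j) (v := w)
    (by simp [hG1, SimpleGraph.edge_adj]; grind)
  set G2 := G1 \ SimpleGraph.edge j w with hG2
  have e3 := deg_sup_edge (G := G2) hij (by simp [hG2, hG1, hnij])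
  set G3 := G2 ⊔ SimpleGraph.edge i j with hG3
  have e4 := deg_sup_edge (G := G3) hur.symm
    (by simp [hG3, hG2, hG1, SimpleGraph.edge_adj]; grind)
  set G4 := G3 ⊔ SimpleGraph.edge r u with hG4
  have hd4 : ∀ v, deg G4 v + (if v = w then 1 else 0) = deg G v + if v = r then 1 else 0 := by
    intro v
    have := e1 v
    have := e2 v
    have := e3 v
    have := e4 v
    split_ifs at * <;> grind
  refine ⟨G4, ⟨fun v => ?_, fun v hv => ?_, fun x y hx hxr hy hyr => ?_⟩, ?_⟩
  · have := hG.le v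
    have := hd4 v
    split_ifs at * <;> grind
  · have := hG.full v hv
    have := hd4 v
    split_ifs at * <;> grind
  · have := hG.indep x y hx hxr hy hyr
    simp [hG4, hG3, hG2, hG1, SimpleGraph.edge_adj]
    grind
  · have := hd4 r
    simp [hwr.symm] at this
    omega

/-- Let `X` be `P` with `r`. It is a clique and its complement is independent, so double counting
the edges across makes the degree sum over `X` equal to `|X| (|X| - 1)` plus the degree sum outside.
By `hlow` this is at least the right side of the Erdős–Gallai inequality for `X`, and all of `P` is
already exact. -/
theorem Sub.saturated (hG : Sub d P r G) (hrP : r ∉ P)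
    (hEG : ∀ X : Finset V, ∑ i ∈ X, d i ≤ X.card * (X.card - 1) + ∑ i ∈ Xᶜ, min X.card (d i))
    (hclique : ∀ i ∈ insert r P, ∀ j ∈ insert r P, i ≠ j → G.Adj i j)
    (hlow : ∀ k, k ∉ insert r P → min (P.card + 1) (d k) ≤ deg G k) : d r ≤ deg G r := by
  classical
  set X := insert r P with hX
  have hcard : X.card = P.card + 1 := card_insert_of_notMem hrP
  have hsplit : ∀ x ∈ X, deg G x = (X.card - 1) + (nbrs G x ∩ Xᶜ).card := by
    intro x hx
    have h1 : nbrs G x ∩ X = X.erase x := by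
      ext y
      simp only [mem_inter, mem_nbrs, mem_erase]
      constructor
      · rintro ⟨h, hy⟩; exact ⟨h.ne.symm, hy⟩
      · rintro ⟨h, hy⟩; exact ⟨hclique x hx y hy h.symm, hy⟩
    have h2 := card_inter_add_card_sdiff (nbrs G x) X
    rw [h1, card_erase_of_mem hx, sdiff_eq_inter_compl] at h2
    rw [deg, ← h2]
  have hsum : ∑ x ∈ X, deg G x = X.card * (X.card - 1) + ∑ x ∈ X, (nbrs G x ∩ Xᶜ).card := by
    rw [sum_congr rfl hsplit, sum_add_distrib]
    simp
  have hcount : ∑ x ∈ X, (nbrs G x ∩ Xᶜ).card = ∑ y ∈ Xᶜ, deg G y := by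
    have h1 : ∀ x ∈ X, (nbrs G x ∩ Xᶜ).card = (bipartiteAbove G.Adj Xᶜ x).card := by
      intro x _
      congr 1
      ext y
      simp [bipartiteAbove, and_comm]
    have h2 : ∀ y ∈ Xᶜ, deg G y = (bipartiteBelow G.Adj X y).card := by
      intro y hy
      rw [deg]
      congr 1
      ext x
      simp only [mem_nbrs, bipartiteBelow, mem_filter]
      constructor
      · intro h
        refine ⟨?_, h.symm⟩
        by_contra hx
        simp only [hX, mem_compl, mem_insert, not_or] at hy hx
        exact hG.indep y x hy.2 hy.1 hx.2 hx.1 h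
      · exact fun h => h.2.symm
    rw [sum_congr rfl h1, sum_congr rfl h2]
    exact sum_card_bipartiteAbove_eq_sum_card_bipartiteBelow _
  have hge : ∑ y ∈ Xᶜ, min X.card (d y) ≤ ∑ y ∈ Xᶜ, deg G y := by
    refine sum_le_sum fun y hy => ?_
    rw [hcard]
    exact hlow y (by simpa using hy)
  have h := hEG X
  rw [hX, sum_insert hrP, ← hX] at h
  have hP : ∑ v ∈ P, deg G v = ∑ v ∈ P, d v := sum_congr rfl fun v hv => hG.full v hv
  rw [hX, sum_insert hrP, ← hX, hP] at hsum
  omega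

/-- If none of the four exchanges applies, the graph satisfies the assumptions of `Sub.saturated`,
so `r` is not deficient. -/
theorem Sub.improve (hG : Sub d P r G) (hrP : r ∉ P)
    (heven : Even (∑ v, d v)) (hmax : ∀ v ∈ P, d r ≤ d v)
    (hEG : ∀ X : Finset V, ∑ i ∈ X, d i ≤ X.card * (X.card - 1) + ∑ i ∈ Xᶜ, min X.card (d i))
    (hr : deg G r < d r) : ∃ G', Sub d P r G' ∧ deg G r < deg G' r := by
  by_contra hno
  have h0 : ∀ s, s ∉ P → s ≠ r → deg G s < d s → G.Adj r s := fun s hsP hsr hds => by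
    by_contra hs
    exact hno (hG.improve_edge hsr hs hds hr hsP hrP)
  have h1 : ∀ i ∈ P, G.Adj r i := fun i hi => by
    by_contra hri
    exact hno (hG.improve_nonadj_full hr hrP heven hmax h0 hi hri)
  refine absurd hr (not_lt.2 (hG.saturated hrP hEG ?_ ?_))
  · intro i hi j hj hij
    rw [mem_insert] at hi hj
    rcases hi with rfl | hi
    · exact h1 j (hj.resolve_left hij.symm)
    · rcases hj with rfl | hj
      · exact (h1 i hi).symm
      · by_contra hnij
        exact hno (hG.improve_nonclique hr hrP hmax h1 hi hj hij hnij)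
  · intro k hk
    simp only [mem_insert, not_or] at hk
    by_contra! hlt
    rw [lt_min_iff] at hlt
    exact hno (hG.improve_low hr hrP hmax h1 hk.2 hk.1 (h0 k hk.2 hk.1 hlt.2) hlt.2 hlt.1)

theorem Sub.fill (hrP : r ∉ P)
    (heven : Even (∑ v, d v)) (hmax : ∀ v ∈ P, d r ≤ d v)
    (hEG : ∀ X : Finset V, ∑ i ∈ X, d i ≤ X.card * (X.card - 1) + ∑ i ∈ Xᶜ, min X.card (d i))
    (m : ℕ) : ∀ G, Sub d P r G → d r - deg G r ≤ m → ∃ G', Sub d P r G' ∧ deg G' r = d r := by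
  induction m with
  | zero => exact fun G hG h => ⟨G, hG, le_antisymm (hG.le r) (by omega)⟩
  | succ m ih =>
    intro G hG h
    by_cases hr : deg G r < d r
    · obtain ⟨G', hG', h'⟩ := hG.improve hrP heven hmax hEG hr
      exact ih G' hG' (by omega)
    · exact ⟨G, hG, le_antisymm (hG.le r) (by omega)⟩

/-- The sufficiency half of the Erdős–Gallai theorem, by growing a subrealization. -/
theorem exists_graph (heven : Even (∑ v, d v))
    (hEG : ∀ X : Finset V, ∑ i ∈ X, d i ≤ X.card * (X.card - 1) + ∑ i ∈ Xᶜ, min X.card (d i)) :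
    ∃ G : SimpleGraph V, ∀ v, deg G v = d v := by
  -- Vertices are completed in decreasing order of `d`, which provides `d r ≤ d v` on `P` for every
  -- exchange.
  have key : ∀ m : ℕ, ∀ P : Finset V, Pᶜ.card = m → (∀ v ∈ P, ∀ u, u ∉ P → d u ≤ d v) →
      (∃ G, (∀ v, deg G v ≤ d v) ∧ (∀ v ∈ P, deg G v = d v) ∧
        ∀ u v, u ∉ P → v ∉ P → ¬ G.Adj u v) →
      ∃ G : SimpleGraph V, ∀ v, deg G v = d v := by
    intro m
    induction m with
    | zero =>
      rintro P hP - ⟨G, -, hfull, -⟩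
      rw [card_eq_zero, compl_eq_empty_iff] at hP
      exact ⟨G, fun v => hfull v (hP ▸ mem_univ v)⟩
    | succ m ih =>
      rintro P hP hmono ⟨G, hle, hfull, hind⟩
      obtain ⟨r, hr, hmax⟩ := exists_max_image Pᶜ d (card_pos.1 (by omega))
      have hrP : r ∉ P := by simpa using hr
      obtain ⟨G', hG', hr'⟩ := Sub.fill hrP heven (fun v hv => hmono v hv r hrP) hEG _ G
        ⟨hle, hfull, fun u v hu _ hv _ => hind u v hu hv⟩ le_rfl
      refine ih (insert r P) ?_ ?_ ⟨G', hG'.le, ?_, ?_⟩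
      · rw [compl_insert, card_erase_of_mem hr]; omega
      · intro v hv u hu
        simp only [mem_insert, not_or] at hv hu
        rcases hv with rfl | hv
        · exact hmax u (by simpa using hu.2)
        · exact hmono v hv u hu.2
      · intro v hv
        rw [mem_insert] at hv
        rcases hv with rfl | hv
        · exact hr'
        · exact hG'.full v hv
      · intro u v hu hv
        simp only [mem_insert, not_or] at hv hu
        exact hG'.indep u v hu.2 hu.1 hv.2 hv.1
  refine key _ ∅ rfl (by simp) ⟨⊥, fun v => ?_, by simp, by simp⟩
  simp [deg, nbrs]

end EG

/-! ### The inequalities of Koren -/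

namespace EG

open Finset

variable {V : Type*}

/-- By how much the sequence `d` overloads the pair `X ⊆ W`: a sequence with even sum is graphic
iff no pair has an excess beyond the sum of `d`. -/
def excess (d : V → ℕ) (X W : Finset V) : ℤ :=
  ∑ i ∈ X, (d i : ℤ) + ∑ i ∈ W, (d i : ℤ) - X.card * (W.card - 1)

theorem excess_erase_left [DecidableEq V] {d : V → ℕ} {X W : Finset V} {i : V} (hi : i ∈ X) :
    excess d (X.erase i) W = excess d X W - d i + (W.card - 1) := by
  have h1 := add_sum_erase X (fun i => (d i : ℤ)) hi
  have h2 : ((X.erase i).card : ℤ) = X.card - 1 := by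
    rw [card_erase_of_mem hi, Nat.cast_sub (card_pos.2 ⟨i, hi⟩)]; simp
  simp only [excess, h2]
  linear_combination h1

theorem excess_insert_left [DecidableEq V] {d : V → ℕ} {X W : Finset V} {i : V} (hi : i ∉ X) :
    excess d (insert i X) W = excess d X W + d i - (W.card - 1) := by
  simp only [excess, sum_insert hi, card_insert_of_notMem hi]
  push_cast
  ring

theorem excess_erase_right [DecidableEq V] {d : V → ℕ} {X W : Finset V} {i : V} (hi : i ∈ W) :
    excess d X (W.erase i) = excess d X W - d i + X.card := by
  have h1 := add_sum_erase W (fun i => (d i : ℤ)) hi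
  have h2 : ((W.erase i).card : ℤ) = W.card - 1 := by
    rw [card_erase_of_mem hi, Nat.cast_sub (card_pos.2 ⟨i, hi⟩)]; simp
  simp only [excess, h2]
  linear_combination h1

theorem excess_insert_right [DecidableEq V] {d : V → ℕ} {X W : Finset V} {i : V} (hi : i ∉ W) :
    excess d X (insert i W) = excess d X W + d i - X.card := by
  simp only [excess, sum_insert hi, card_insert_of_notMem hi]
  push_cast
  ring

theorem excess_mono {d e : V → ℕ} (h : ∀ i, d i ≤ e i) (X W : Finset V) :
    excess d X W ≤ excess e X W := by
  have h1 : ∑ i ∈ X, (d i : ℤ) ≤ ∑ i ∈ X, (e i : ℤ) :=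
    sum_le_sum fun i _ => by exact_mod_cast h i
  have h2 : ∑ i ∈ W, (d i : ℤ) ≤ ∑ i ∈ W, (e i : ℤ) :=
    sum_le_sum fun i _ => by exact_mod_cast h i
  simp only [excess]
  linarith

/-- A vertex of `X` contributes `d i - (|W| - 1)`, so discarding nonpositive contributions cannot
lower the excess. The next three lemmas are the analogues; a vertex of `W` contributes `d i - |X|`.
-/
theorem excess_filter_left {d : V → ℕ} {X W : Finset V} (p : V → Prop) [DecidablePred p]
    (h : ∀ i ∈ X, ¬ p i → (d i : ℤ) ≤ W.card - 1) :
    excess d X W ≤ excess d (X.filter p) W := by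
  have h1 := sum_filter_add_sum_filter_not X p (fun i => (d i : ℤ) - (W.card - 1))
  have h2 : ∑ i ∈ X.filter (fun i => ¬ p i), ((d i : ℤ) - (W.card - 1)) ≤ 0 := by
    refine sum_nonpos fun i hi => ?_
    rw [mem_filter] at hi
    have := h i hi.1 hi.2
    linarith
  simp only [sum_sub_distrib, sum_const, nsmul_eq_mul] at h1 h2
  simp only [excess]
  linarith

theorem excess_union_left [DecidableEq V] {d : V → ℕ} {X W Z : Finset V} (hd : Disjoint X Z)
    (h : ∀ i ∈ Z, (W.card : ℤ) - 1 ≤ d i) :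
    excess d X W ≤ excess d (X ∪ Z) W := by
  have h2 : 0 ≤ ∑ i ∈ Z, ((d i : ℤ) - (W.card - 1)) := by
    refine sum_nonneg fun i hi => ?_
    have := h i hi
    linarith
  rw [sum_sub_distrib] at h2
  simp only [sum_const, nsmul_eq_mul] at h2
  simp only [excess, sum_union hd, card_union_of_disjoint hd]
  push_cast
  linarith

theorem excess_filter_right {d : V → ℕ} {X W : Finset V} (p : V → Prop) [DecidablePred p]
    (h : ∀ i ∈ W, ¬ p i → d i ≤ X.card) :
    excess d X W ≤ excess d X (W.filter p) := by
  have h1 := sum_filter_add_sum_filter_not W p (fun i => (d i : ℤ) - X.card)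
  have h2 : ∑ i ∈ W.filter (fun i => ¬ p i), ((d i : ℤ) - X.card) ≤ 0 := by
    refine sum_nonpos fun i hi => ?_
    rw [mem_filter] at hi
    have := h i hi.1 hi.2
    have : (d i : ℤ) ≤ X.card := by exact_mod_cast this
    linarith
  simp only [sum_sub_distrib, sum_const, nsmul_eq_mul] at h1 h2
  simp only [excess]
  linarith

theorem excess_union_right [DecidableEq V] {d : V → ℕ} {X W Z : Finset V} (hd : Disjoint W Z)
    (h : ∀ i ∈ Z, X.card ≤ d i) :
    excess d X W ≤ excess d X (W ∪ Z) := by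
  have h2 : 0 ≤ ∑ i ∈ Z, ((d i : ℤ) - X.card) := by
    refine sum_nonneg fun i hi => ?_
    have : (X.card : ℤ) ≤ d i := by exact_mod_cast h i hi
    linarith
  rw [sum_sub_distrib] at h2
  simp only [sum_const, nsmul_eq_mul] at h2
  simp only [excess, sum_union hd, card_union_of_disjoint hd]
  push_cast
  linarith

/-! ### Necessity and sufficiency of the inequalities, and threshold sets. -/

variable [Fintype V] [DecidableEq V]

/-- A sequence is feasible if no pair has an excess beyond its sum. -/
def Feasible (d : V → ℕ) : Prop :=
  ∀ X W : Finset V, X ⊆ W → excess d X W ≤ ∑ i, (d i : ℤ)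

/-- A vertex of `X` has at most `|W| - 1` neighbours in `W`, and the edges from `X` to the
complement of `W` are counted by the degrees there. -/
theorem feasible_deg (G : SimpleGraph V) : Feasible (deg G) := by
  intro X W hXW
  have h1 : ∀ x ∈ X, (deg G x : ℤ) ≤ (W.card - 1) + ((nbrs G x ∩ Wᶜ).card : ℤ) := by
    intro x hx
    have h2 := card_inter_add_card_sdiff (nbrs G x) W
    have h3 : nbrs G x ∩ W ⊆ W.erase x := by
      intro y hy
      rw [mem_inter, mem_nbrs] at hy
      exact mem_erase.2 ⟨hy.1.ne.symm, hy.2⟩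
    have h4 := card_le_card h3
    rw [card_erase_of_mem (hXW hx)] at h4
    have h5 : 0 < W.card := card_pos.2 ⟨x, hXW hx⟩
    rw [sdiff_eq_inter_compl] at h2
    rw [deg]
    omega
  have h2 : ∑ x ∈ X, (nbrs G x ∩ Wᶜ).card ≤ ∑ y ∈ Wᶜ, deg G y := by
    classical
    have h3 : ∀ x ∈ X, (nbrs G x ∩ Wᶜ).card = (bipartiteAbove G.Adj Wᶜ x).card := by
      intro x _
      congr 1
      ext y
      simp [bipartiteAbove, and_comm]
    rw [sum_congr rfl h3, sum_card_bipartiteAbove_eq_sum_card_bipartiteBelow]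
    refine sum_le_sum fun y _ => card_le_card fun x hx => ?_
    rw [bipartiteBelow, mem_filter] at hx
    simpa using hx.2.symm
  have h3 := sum_le_sum h1
  rw [sum_add_distrib, sum_const, nsmul_eq_mul] at h3
  have h4 := sum_add_sum_compl W fun i => (deg G i : ℤ)
  have h5 : ∑ x ∈ X, ((nbrs G x ∩ Wᶜ).card : ℤ) ≤ ∑ y ∈ Wᶜ, (deg G y : ℤ) := by
    exact_mod_cast h2
  simp only [excess]
  linarith

/-- The Erdős–Gallai inequality for `X` is the case in which `W` adds to `X` exactly the outer
vertices whose minimum with `|X|` is `|X|`. -/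
theorem Feasible.exists_graph {d : V → ℕ} (hd : Feasible d) (heven : Even (∑ v, d v)) :
    ∃ G : SimpleGraph V, ∀ v, deg G v = d v := by
  refine EG.exists_graph heven fun X => ?_
  set Z := Xᶜ.filter fun i => X.card ≤ d i with hZ
  have hdisj : Disjoint X Z := by
    rw [disjoint_left]
    intro i hi hiZ
    simp [hZ, hi] at hiZ
  have h1 := hd X (X ∪ Z) subset_union_left
  have h2 := sum_filter_add_sum_filter_not Xᶜ (fun i => X.card ≤ d i) (fun i => min X.card (d i))
  have h3 := sum_filter_add_sum_filter_not Xᶜ (fun i => X.card ≤ d i) (fun i => (d i : ℤ))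
  have h4 := sum_add_sum_compl X fun i => (d i : ℤ)
  rw [← hZ] at h2 h3
  have h5 : ∑ i ∈ Z, min X.card (d i) = Z.card * X.card := by
    rw [sum_congr rfl (g := fun _ => X.card), sum_const, smul_eq_mul]
    intro i hi
    exact min_eq_left (mem_filter.1 hi).2
  have h6 : ∑ i ∈ Xᶜ with ¬ X.card ≤ d i, min X.card (d i) =
      ∑ i ∈ Xᶜ with ¬ X.card ≤ d i, d i := by
    refine sum_congr rfl fun i hi => ?_
    have := (mem_filter.1 hi).2
    exact min_eq_right (by omega)
  rw [h5, h6] at h2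
  have h7 : ((X.card - 1 : ℕ) : ℤ) * X.card = (X.card - 1) * X.card := by
    rcases Nat.eq_zero_or_pos X.card with h | h
    · simp [h]
    · rw [Nat.cast_sub h]; simp
  rw [← h2, ← Nat.cast_le (α := ℤ)]
  push_cast
  simp only [excess, sum_union hdisj, card_union_of_disjoint hdisj] at h1
  push_cast at h1
  nlinarith

/-- The largest excess is attained at a pair of threshold sets. -/
theorem exists_threshold (d : V → ℕ) {X W : Finset V} (hXW : X ⊆ W) :
    ∃ p ≤ Fintype.card V, ∃ k, k = (univ.filter fun i => p ≤ d i).card ∧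
      excess d X W ≤
        excess d (univ.filter fun i => p ≤ d i) (univ.filter fun i => min k p ≤ d i) := by
  set S := (univ : Finset (Finset V × Finset V)).filter fun q => q.1 ⊆ q.2 with hS
  obtain ⟨q₀, hq₀, hmax₀⟩ := exists_max_image S (fun q => excess d q.1 q.2)
    ⟨(∅, ∅), by simp [hS]⟩
  -- Ties are broken towards small `A` and large `B`. Adding or removing one vertex then shows that
  -- `A` is the set of values at least `|B|` and `B` that of values at least `|A|`.
  obtain ⟨⟨A, B⟩, hAB, hmax₁⟩ := exists_max_image
    (S.filter fun q => excess d q₀.1 q₀.2 ≤ excess d q.1 q.2)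
    (fun q => -(q.1.card : ℤ) + q.2.card) ⟨q₀, by simp [hq₀]⟩
  rw [mem_filter] at hAB
  have hsub : A ⊆ B := by simpa [hS] using hAB.1
  have hmax : ∀ A' B', A' ⊆ B' → excess d A' B' ≤ excess d A B := fun A' B' h =>
    (hmax₀ (A', B') (by simpa [hS] using h)).trans hAB.2
  have hmax' : ∀ A' B', A' ⊆ B' → excess d A' B' < excess d A B ∨
      excess d A' B' = excess d A B ∧ -(A'.card : ℤ) + B'.card ≤ -A.card + B.card := by
    intro A' B' h
    rcases (hmax A' B' h).lt_or_eq with h' | h'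
    · exact Or.inl h'
    · exact Or.inr ⟨h', hmax₁ (A', B')
        (mem_filter.2 ⟨by simpa [hS] using h, hAB.2.trans h'.ge⟩)⟩
  have hcard := card_le_card hsub
  have c1 : ∀ i ∈ A, B.card ≤ d i := by
    intro i hi
    have := hmax' (A.erase i) B ((erase_subset _ _).trans hsub)
    rw [excess_erase_left hi, card_erase_of_mem hi] at this
    have : 0 < A.card := card_pos.2 ⟨i, hi⟩
    omega
  have c2 : ∀ i ∈ B, i ∉ A → d i < B.card := by
    intro i hi hiA
    have := hmax' (insert i A) B (insert_subset hi hsub)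
    rw [excess_insert_left hiA, card_insert_of_notMem hiA] at this
    have : 0 < B.card := card_pos.2 ⟨i, hi⟩
    omega
  have c3 : ∀ i ∈ B, i ∉ A → A.card ≤ d i := by
    intro i hi hiA
    have := hmax' A (B.erase i) fun x hx =>
      mem_erase.2 ⟨fun h => hiA (h ▸ hx), hsub hx⟩
    rw [excess_erase_right hi, card_erase_of_mem hi] at this
    have : 0 < B.card := card_pos.2 ⟨i, hi⟩
    omega
  have c4 : ∀ i, i ∉ B → d i < A.card := by
    intro i hi
    have := hmax' A (insert i B) (hsub.trans (subset_insert _ _))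
    rw [excess_insert_right hi, card_insert_of_notMem hi] at this
    omega
  have hA : (univ.filter fun i => B.card ≤ d i) = A := by
    ext i
    simp only [mem_filter, mem_univ, true_and]
    by_cases hiA : i ∈ A
    · simp [hiA, c1 i hiA]
    · by_cases hiB : i ∈ B
      · simp [hiA, c2 i hiB hiA]
      · have := c4 i hiB
        simp [hiA]; omega
  have hB : (univ.filter fun i => min A.card B.card ≤ d i) = B := by
    rw [min_eq_left hcard]
    ext i
    simp only [mem_filter, mem_univ, true_and]
    by_cases hiB : i ∈ B
    · by_cases hiA : i ∈ A
      · have := c1 i hiA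
        simp [hiB]; omega
      · simp [hiB, c3 i hiB hiA]
    · simp [hiB, c4 i hiB]
  refine ⟨B.card, card_le_univ B, A.card, by rw [hA], ?_⟩
  rw [hA, hB]
  exact hmax X W hXW

end EG

/-! ### Levelled sequences -/

namespace EG

open Finset

variable {V : Type*} [Fintype V] [DecidableEq V] {d : V → ℕ} {L : ℕ}

/-- A pair whose sets are separated from the levels `L` and `L + 1` of `d` by their values. -/
def Split (d : V → ℕ) (L : ℕ) (X W : Finset V) : Prop :=
  (∀ i ∈ W, L + 2 ≤ d i) ∨ (∀ i, i ∉ X → d i < L) ∨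
    (∀ i ∈ X, L + 2 ≤ d i) ∧ ∀ i, i ∉ W → d i < L

/-- As `|W| - 1` is at least `L + 1`, `X` can shed all values up to `L + 1`. What remains of `X` has
either at most `L` elements, and then `W` can absorb all values from `L` on, or more, and then `W`
can shed all values up to `L + 1`. -/
theorem exists_split_of_card_right {X W : Finset V} (hXW : X ⊆ W) (hW : L + 2 ≤ W.card) :
    ∃ X' W', X' ⊆ W' ∧ excess d X W ≤ excess d X' W' ∧ Split d L X' W' := by
  have h1 : excess d X W ≤ excess d (X.filter fun i => L + 2 ≤ d i) W :=
    excess_filter_left _ fun i _ hi => by omega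
  set A := X.filter fun i => L + 2 ≤ d i with hA
  have hAd : ∀ i ∈ A, L + 2 ≤ d i := fun i hi => (mem_filter.1 hi).2
  have hAW : A ⊆ W := (filter_subset _ _).trans hXW
  by_cases hc : A.card ≤ L
  · refine ⟨A, W ∪ Wᶜ.filter fun i => L ≤ d i, hAW.trans subset_union_left, h1.trans ?_,
      Or.inr (Or.inr ⟨hAd, fun i hi => ?_⟩)⟩
    · refine excess_union_right ?_ fun i hi => hc.trans (mem_filter.1 hi).2
      exact disjoint_compl_right.mono_right (filter_subset _ _)
    · simp only [mem_union, mem_filter, mem_compl] at hi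
      by_contra! hlt
      tauto
  · refine ⟨A, W.filter fun i => L + 2 ≤ d i, fun i hi => mem_filter.2 ⟨hAW hi, hAd i hi⟩,
      h1.trans (excess_filter_right _ fun i _ hi => by omega),
      Or.inl fun i hi => (mem_filter.1 hi).2⟩

/-- Here `W` can first absorb all values from `L` on. If it is still too small for the previous
lemma, `|W| - 1 ≤ L` lets `X` absorb them too. -/
theorem exists_split_of_card_left {X W : Finset V} (hXW : X ⊆ W) (hX : X.card ≤ L) :
    ∃ X' W', X' ⊆ W' ∧ excess d X W ≤ excess d X' W' ∧ Split d L X' W' := by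
  set B := W ∪ Wᶜ.filter fun i => L ≤ d i with hB
  have hXB : X ⊆ B := hXW.trans subset_union_left
  have h1 : excess d X W ≤ excess d X B :=
    excess_union_right (disjoint_compl_right.mono_right (filter_subset _ _))
      fun i hi => hX.trans (mem_filter.1 hi).2
  have hBd : ∀ i, i ∉ B → d i < L := by
    intro i hi
    simp only [hB, mem_union, mem_filter, mem_compl] at hi
    by_contra! hlt
    tauto
  by_cases hc : L + 2 ≤ B.card
  · obtain ⟨X', W', h, h', hs⟩ := exists_split_of_card_right (d := d) hXB hc
    exact ⟨X', W', h, h1.trans h', hs⟩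
  · refine ⟨X ∪ (B \ X).filter fun i => L ≤ d i, B, ?_, h1.trans (excess_union_left ?_ ?_),
      Or.inr (Or.inl fun i hi => ?_)⟩
    · exact union_subset hXB ((filter_subset _ _).trans sdiff_subset)
    · exact disjoint_sdiff.mono_right (filter_subset _ _)
    · intro i hi
      have := (mem_filter.1 hi).2
      omega
    · simp only [mem_union, mem_filter, mem_sdiff] at hi
      by_contra hlt
      have := hBd i
      rw [not_lt] at hlt
      grind

theorem exists_split (heven : Even (∑ i, d i)) {X W : Finset V} (hXW : X ⊆ W)
    (h : ∑ i, (d i : ℤ) < excess d X W) :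
    ∃ X' W', X' ⊆ W' ∧ ∑ i, (d i : ℤ) < excess d X' W' ∧ Split d L X' W' := by
  by_cases hW : L + 2 ≤ W.card
  · obtain ⟨X', W', h1, h2, hs⟩ := exists_split_of_card_right (d := d) hXW hW
    exact ⟨X', W', h1, h.trans_le h2, hs⟩
  by_cases hX : X.card ≤ L
  · obtain ⟨X', W', h1, h2, hs⟩ := exists_split_of_card_left (d := d) hXW hX
    exact ⟨X', W', h1, h.trans_le h2, hs⟩
  obtain rfl : X = W := eq_of_subset_of_card_le hXW (by omega)
  have hcard : X.card = L + 1 := by omega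
  -- In the remaining case `|X| = |W| = L + 1` the product `L (L + 1)` is even, so the overload is
  -- at least two. One vertex may therefore be moved at a cost of one, to reach a size treated
  -- above.
  have h2 : ∑ i, (d i : ℤ) + 2 ≤ excess d X X := by
    obtain ⟨s, hs⟩ := heven
    obtain ⟨l, hl⟩ := Nat.even_mul_succ_self L
    have hs' : ∑ i, (d i : ℤ) = s + s := by exact_mod_cast hs
    have hl' : (L : ℤ) * (L + 1) = l + l := by exact_mod_cast hl
    have he : excess d X X = 2 * ∑ i ∈ X, (d i : ℤ) - 2 * l := by
      simp only [excess, hcard]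
      push_cast
      linarith
    rw [hs', he] at h ⊢
    omega
  by_cases h3 : ∃ i ∈ X, d i ≤ L + 1
  · obtain ⟨i, hi, hdi⟩ := h3
    have h4 := excess_erase_left (d := d) (W := X) hi
    obtain ⟨X', W', h5, h6, hs⟩ := exists_split_of_card_left (d := d) (L := L) (erase_subset i X)
      (by rw [card_erase_of_mem hi]; omega)
    exact ⟨X', W', h5, by omega, hs⟩
  by_cases h4 : ∃ i, i ∉ X ∧ L ≤ d i
  · obtain ⟨i, hi, hdi⟩ := h4
    have h4 := excess_insert_right (d := d) (X := X) hi
    obtain ⟨X', W', h5, h6, hs⟩ := exists_split_of_card_right (d := d) (L := L) (subset_insert i X)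
      (by rw [card_insert_of_notMem hi]; omega)
    exact ⟨X', W', h5, by omega, hs⟩
  push Not at h3
  exact ⟨X, X, Subset.rfl, h, Or.inl fun i hi => h3 i hi⟩

/-- If a levelled sequence is not feasible, although its sum is large enough for the lower bounds,
then no sequence within the same bounds with at least the same sum is feasible. -/
theorem feasible_of_levelled {a b e : V → ℕ}
    (hlow : ∀ i, L + 2 ≤ d i → d i = a i) (hhigh : ∀ i, d i < L → d i = b i)
    (heven : Even (∑ i, d i))
    (ha : ∀ X W : Finset V, X ⊆ W → excess a X W ≤ ∑ i, (d i : ℤ))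
    (he : Feasible e) (hae : ∀ i, a i ≤ e i) (heb : ∀ i, e i ≤ b i)
    (hsum : ∑ i, d i ≤ ∑ i, e i) : Feasible d := by
  intro X W hXW
  by_contra! hlt
  obtain ⟨A, B, hAB, hex, hs⟩ := exists_split (L := L) heven hXW hlt
  have hsum' : ∑ i, (d i : ℤ) ≤ ∑ i, (e i : ℤ) := by exact_mod_cast hsum
  have hge : ∀ Z : Finset V, (∀ i ∈ Z, L + 2 ≤ d i) → ∑ i ∈ Z, (d i : ℤ) ≤ ∑ i ∈ Z, (e i : ℤ) :=
    fun Z hZ => sum_le_sum fun i hi => by exact_mod_cast (hlow i (hZ i hi)).trans_le (hae i)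
  have hle : ∀ Z : Finset V, (∀ i, i ∉ Z → d i < L) →
      ∑ i ∈ Zᶜ, (e i : ℤ) ≤ ∑ i ∈ Zᶜ, (d i : ℤ) := by
    refine fun Z hZ => sum_le_sum fun i hi => ?_
    exact_mod_cast (heb i).trans_eq (hhigh i (hZ i (by simpa using hi))).symm
  have hf := he A B hAB
  have h1 := sum_add_sum_compl A fun i => (d i : ℤ)
  have h2 := sum_add_sum_compl B fun i => (d i : ℤ)
  have h3 := sum_add_sum_compl A fun i => (e i : ℤ)
  have h4 := sum_add_sum_compl B fun i => (e i : ℤ)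
  simp only [excess] at hf hex
  -- In the first case `d` is `a` on both sets. In the others, excess minus sum is the sum minus the
  -- sums over both complements, or the sum over `A` minus that over the complement of `B`, up to a
  -- term without `d`; replacing `d` by `e` does not decrease it.
  rcases hs with hs | hs | ⟨hs, hs'⟩
  · have h5 := ha A B hAB
    have h6 : excess a A B = excess d A B := by
      simp only [excess]
      congr 2 <;> refine sum_congr rfl fun i hi => ?_
      · rw [hlow i (hs i (hAB hi))]
      · rw [hlow i (hs i hi)]
    rw [h6, excess] at h5
    linarith
  · have h5 := hle A hs
    have h6 := hle B fun i hi => hs i fun h => hi (hAB h)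
    linarith
  · have h5 := hge A hs
    have h6 := hle B hs'
    linarith

end EG

/-! ### Certificates of interval sequences -/

open EG in
theorem degreeSeq_eq_deg {n : ℕ} (G : SimpleGraph (Fin n)) : degreeSeq G = deg G := by
  funext v
  classical
  rw [deg_eq_degree, degreeSeq]

open EG in
theorem isGraphic_iff {n : ℕ} (D : Fin n → ℕ) :
    IsGraphic D ↔ Even (∑ i, D i) ∧ Feasible D := by
  constructor
  · rintro ⟨G, rfl⟩
    rw [degreeSeq_eq_deg]
    exact ⟨even_sum_deg G, feasible_deg G⟩
  · rintro ⟨h1, h2⟩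
    obtain ⟨G, hG⟩ := h2.exists_graph h1
    exact ⟨G, by rw [degreeSeq_eq_deg]; exact funext hG⟩

open EG in
theorem two_mul_ncard_edgeSet {n : ℕ} (G : SimpleGraph (Fin n)) :
    2 * G.edgeSet.ncard = ∑ i, degreeSeq G i := by
  classical
  rw [degreeSeq_eq_deg, ← SimpleGraph.coe_edgeFinset, Set.ncard_coe_finset,
    ← SimpleGraph.sum_degrees_eq_twice_card_edges]
  exact Finset.sum_congr rfl fun v _ => (deg_eq_degree G v).symm

open EG in
theorem degreeSeq_compl {n : ℕ} (G : SimpleGraph (Fin n)) (i : Fin n) :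
    degreeSeq Gᶜ i = n - 1 - degreeSeq G i := by
  classical
  rw [degreeSeq_eq_deg, degreeSeq_eq_deg, deg_eq_degree, deg_eq_degree, SimpleGraph.degree_compl,
    Fintype.card_fin]

theorem degreeSeq_lt {n : ℕ} (G : SimpleGraph (Fin n)) (i : Fin n) : degreeSeq G i < n := by
  classical
  have := G.degree_lt_card_verts i
  rw [Fintype.card_fin] at this
  rw [degreeSeq_eq_deg, EG.deg_eq_degree]
  exact this

namespace IntervalSeq

open EG

variable {n : ℕ} {S : IntervalSeq n} {D : Fin n → ℕ}

theorem IsSparsestCertificate.isCertificate (h : S.IsSparsestCertificate D) :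
    S.IsCertificate D := by
  obtain ⟨G, rfl, hG, -⟩ := h
  exact ⟨⟨G, rfl⟩, hG⟩

theorem IsCertificate.isSparsestCertificate (h : S.IsCertificate D)
    (hmin : ∀ E, S.IsCertificate E → ∑ i, D i ≤ ∑ i, E i) : S.IsSparsestCertificate D := by
  obtain ⟨⟨G, rfl⟩, hG⟩ := h
  refine ⟨G, rfl, hG, fun H hH => ?_⟩
  have := hmin _ ⟨⟨H, rfl⟩, hH⟩
  rw [← two_mul_ncard_edgeSet, ← two_mul_ncard_edgeSet] at this
  omega

/-- The intervals for the degrees of the complementary graphs. -/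
def compl (S : IntervalSeq n) : IntervalSeq n where
  lower i := n - 1 - S.upper i
  upper i := n - 1 - S.lower i
  lower_le_upper i := by have := S.lower_le_upper i; omega
  upper_lt i := by have := i.2; omega

theorem realizedBy_compl {G : SimpleGraph (Fin n)} : S.compl.RealizedBy Gᶜ ↔ S.RealizedBy G := by
  refine forall_congr' fun i => ?_
  have := S.lower_le_upper i
  have := S.upper_lt i
  have := degreeSeq_lt G i
  rw [degreeSeq_compl]
  simp only [compl]
  omega

theorem realizable_iff : S.Realizable ↔ ∃ G, S.RealizedBy G :=
  ⟨fun ⟨_, ⟨G, rfl⟩, hG⟩ => ⟨G, hG⟩, fun ⟨G, hG⟩ => ⟨_, ⟨G, rfl⟩, hG⟩⟩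

theorem Realizable.compl (h : S.Realizable) : S.compl.Realizable := by
  rw [realizable_iff] at *
  obtain ⟨G, hG⟩ := h
  exact ⟨Gᶜ, realizedBy_compl.2 hG⟩

theorem two_mul_ncard_edgeSet_compl (G : SimpleGraph (Fin n)) :
    2 * Gᶜ.edgeSet.ncard + 2 * G.edgeSet.ncard = n * (n - 1) := by
  rw [two_mul_ncard_edgeSet, two_mul_ncard_edgeSet, ← Finset.sum_add_distrib,
    Finset.sum_congr rfl (g := fun _ => n - 1)]
  · simp
  · intro i _
    have := degreeSeq_lt G i
    rw [degreeSeq_compl]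
    omega

/-- The edge numbers of a graph and its complement have a constant sum. -/
theorem IsSparsestCertificate.compl (h : S.compl.IsSparsestCertificate D) :
    S.IsDensestCertificate fun i => n - 1 - D i := by
  obtain ⟨G, rfl, hG, hmin⟩ := h
  refine ⟨Gᶜ, funext (degreeSeq_compl G), ?_, fun H hH => ?_⟩
  · rw [← realizedBy_compl, compl_compl]
    exact hG
  · have h1 := hmin Hᶜ (realizedBy_compl.2 hH)
    have h2 := two_mul_ncard_edgeSet_compl H
    have h3 := two_mul_ncard_edgeSet_compl G
    omega

/-- Every certificate has at least the sum that the lower bounds enforce, rounded up to an even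
number. -/
theorem IsCertificate.le_sum {M : ℕ} (h : S.IsCertificate D)
    (hM : ∀ B : ℕ, (∀ X W : Finset (Fin n), X ⊆ W → excess S.lower X W ≤ B) → M ≤ B) :
    2 * ((M + 1) / 2) ≤ ∑ i, D i := by
  obtain ⟨hD, hS⟩ := h
  obtain ⟨⟨k, hk⟩, hf⟩ := (isGraphic_iff D).1 hD
  have := hM (∑ i, D i) fun X W hXW => by
    push_cast
    exact (excess_mono (fun i => (hS i).1) X W).trans (hf X W hXW)
  omega

theorem isSparsestCertificate_of_feasible {M : ℕ}
    (hM : ∀ B : ℕ, (∀ X W : Finset (Fin n), X ⊆ W → excess S.lower X W ≤ B) → M ≤ B)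
    (hsum : ∑ i, D i = 2 * ((M + 1) / 2)) (hS : S.Contains D) (hD : Feasible D) :
    S.IsSparsestCertificate D := by
  refine IsCertificate.isSparsestCertificate
    ⟨(isGraphic_iff D).2 ⟨hsum ▸ even_two_mul _, hD⟩, hS⟩ fun E hE => ?_
  rw [hsum]
  exact hE.le_sum hM

/-- By `hM`, `M` is the largest excess of the lower bounds, so any certificate can serve as the
comparison sequence of `feasible_of_levelled`: its sum is at least the target. -/
theorem Realizable.feasible {M L : ℕ} (h : S.Realizable)
    (hM : ∀ B : ℕ, M ≤ B ↔ ∀ X W : Finset (Fin n), X ⊆ W → excess S.lower X W ≤ B)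
    (hsum : ∑ i, D i = 2 * ((M + 1) / 2))
    (hlow : ∀ i, L + 2 ≤ D i → D i = S.lower i) (hhigh : ∀ i, D i < L → D i = S.upper i) :
    Feasible D := by
  obtain ⟨E, hE⟩ := h
  refine feasible_of_levelled hlow hhigh (hsum ▸ even_two_mul _) ?_ ((isGraphic_iff E).1 hE.1).2
    (fun i => (hE.2 i).1) (fun i => (hE.2 i).2) (hsum ▸ hE.le_sum fun B => (hM B).2)
  have h2 : M ≤ ∑ i, D i := by omega
  exact_mod_cast (hM _).1 h2

theorem Realizable.le_sum_upper {M : ℕ} (h : S.Realizable)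
    (hM : ∀ B : ℕ, (∀ X W : Finset (Fin n), X ⊆ W → excess S.lower X W ≤ B) → M ≤ B) :
    2 * ((M + 1) / 2) ≤ ∑ i, S.upper i := by
  obtain ⟨E, hE⟩ := h
  exact (hE.le_sum hM).trans (Finset.sum_le_sum fun i _ => (hE.2 i).2)

end IntervalSeq

/-! ### The quantities that the program computes -/

namespace Levelling

open Finset

/-- The number of the first `n` entries of `d` that are at least `v`. -/
def cntGE (n : ℕ) (d : ℕ → ℕ) (v : ℕ) : ℕ := ∑ i ∈ range n, if v ≤ d i then 1 else 0

/-- The number of the first `n` entries of `d` that equal `v`. -/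
def cntEq (n : ℕ) (d : ℕ → ℕ) (v : ℕ) : ℕ := ∑ i ∈ range n, if d i = v then 1 else 0

/-- The sum of those of the first `n` entries of `d` that are at least `v`. -/
def sumGE (n : ℕ) (d : ℕ → ℕ) (v : ℕ) : ℕ := ∑ i ∈ range n, if v ≤ d i then d i else 0

/-- The excess of the pair of threshold sets with the upper threshold `p`. -/
def thresholdExcess (n : ℕ) (d : ℕ → ℕ) (p : ℕ) : ℕ :=
  sumGE n d p + sumGE n d (min (cntGE n d p) p) -
    cntGE n d p * (cntGE n d (min (cntGE n d p) p) - 1)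

/-- The largest excess over the upper thresholds below `j`, and the sum of all entries. -/
def maxExcess (n : ℕ) (d : ℕ → ℕ) : ℕ → ℕ
  | 0 => sumGE n d 0
  | j + 1 => max (maxExcess n d j) (thresholdExcess n d j)

variable {n : ℕ} {d : ℕ → ℕ}

theorem maxExcess_congr {e : ℕ → ℕ} (h : ∀ i < n, d i = e i) (j : ℕ) :
    maxExcess n d j = maxExcess n e j := by
  have h1 : cntGE n d = cntGE n e := funext fun v =>
    sum_congr rfl fun i hi => by rw [h i (mem_range.1 hi)]
  have h2 : sumGE n d = sumGE n e := funext fun v =>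
    sum_congr rfl fun i hi => by rw [h i (mem_range.1 hi)]
  induction j with
  | zero => rw [maxExcess, maxExcess, h2]
  | succ j ih => rw [maxExcess, maxExcess, ih, thresholdExcess, thresholdExcess, h1, h2]

theorem cntGE_eq (v : ℕ) : cntGE n d v = (univ.filter fun i : Fin n => v ≤ d i).card := by
  rw [cntGE, Finset.sum_range fun i => if v ≤ d i then 1 else 0, card_filter]

theorem sumGE_eq (v : ℕ) : sumGE n d v = ∑ i ∈ univ.filter (fun i : Fin n => v ≤ d i), d i := by
  rw [sumGE, Finset.sum_range fun i => if v ≤ d i then d i else 0, sum_filter]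

theorem cntGE_le (v : ℕ) : cntGE n d v ≤ n := by
  rw [cntGE_eq]
  exact (card_le_univ _).trans_eq (Fintype.card_fin n)

theorem sumGE_le (hd : ∀ i < n, d i < n) (v : ℕ) : sumGE n d v ≤ n * n := by
  have : ∀ i ∈ range n, (if v ≤ d i then d i else 0) ≤ n := by
    intro i hi
    have := hd i (mem_range.1 hi)
    split_ifs <;> omega
  simpa [sumGE] using sum_le_card_nsmul _ _ _ this

theorem cntGE_of_le (hd : ∀ i < n, d i < n) : cntGE n d n = 0 :=
  sum_eq_zero fun i hi => if_neg (not_le.2 (hd i (mem_range.1 hi)))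

theorem sumGE_of_le (hd : ∀ i < n, d i < n) : sumGE n d n = 0 :=
  sum_eq_zero fun i hi => if_neg (not_le.2 (hd i (mem_range.1 hi)))

theorem cntEq_zero (v : ℕ) : cntEq 0 d v = 0 := rfl

theorem cntEq_succ (v : ℕ) : cntEq (n + 1) d v = cntEq n d v + if d n = v then 1 else 0 :=
  sum_range_succ _ _

theorem cntEq_le (v : ℕ) : cntEq n d v ≤ n := by
  rw [cntEq, ← card_filter]
  exact (card_filter_le _ _).trans_eq (card_range n)

theorem cntGE_eq_add (v : ℕ) :
    cntGE n d v = cntEq n d v + cntGE n d (v + 1) := by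
  rw [cntGE, cntGE, cntEq, ← sum_add_distrib]
  refine sum_congr rfl fun i _ => ?_
  split_ifs <;> omega

theorem sumGE_eq_add (v : ℕ) :
    sumGE n d v = v * cntEq n d v + sumGE n d (v + 1) := by
  rw [sumGE, sumGE, cntEq, mul_sum, ← sum_add_distrib]
  refine sum_congr rfl fun i _ => ?_
  split_ifs <;> simp <;> omega

theorem sumGE_zero : sumGE n d 0 = ∑ i ∈ range n, d i := by simp [sumGE]

theorem thresholdExcess_le (hd : ∀ i < n, d i < n) (p : ℕ) :
    thresholdExcess n d p ≤ 2 * (n * n) := by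
  have h1 := sumGE_le hd p
  have h2 := sumGE_le hd (min (cntGE n d p) p)
  rw [thresholdExcess]
  omega

theorem maxExcess_le (hd : ∀ i < n, d i < n) (j : ℕ) : maxExcess n d j ≤ 2 * (n * n) := by
  induction j with
  | zero => exact (sumGE_le hd 0).trans (by omega)
  | succ j ih => exact max_le ih (thresholdExcess_le hd j)

theorem maxExcess_le_iff_forall {B : ℕ} (j : ℕ) :
    maxExcess n d j ≤ B ↔ sumGE n d 0 ≤ B ∧ ∀ p < j, thresholdExcess n d p ≤ B := by
  induction j with
  | zero => simp [maxExcess]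
  | succ j ih =>
    rw [maxExcess, max_le_iff, ih, Nat.forall_lt_succ_right, and_assoc]

theorem thresholdExcess_le_iff {B : ℕ} (p : ℕ) :
    thresholdExcess n d p ≤ B ↔
      EG.excess (fun i : Fin n => d i) (univ.filter fun i : Fin n => p ≤ d i)
        (univ.filter fun i : Fin n => min (cntGE n d p) p ≤ d i) ≤ B := by
  rw [EG.excess, ← cntGE_eq, ← cntGE_eq, ← Nat.cast_sum, ← Nat.cast_sum, ← sumGE_eq, ← sumGE_eq,
    thresholdExcess]
  set k := cntGE n d p
  set w := cntGE n d (min k p) with hw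
  -- This makes the truncation in `w - 1` harmless: `w = 0` forces the factor `k` to vanish.
  have hkw : k ≤ w := by
    rw [hw]
    refine sum_le_sum fun i _ => ?_
    have := min_le_right k p
    split_ifs <;> omega
  have : ((k * (w - 1) : ℕ) : ℤ) = k * (w - 1) := by
    rcases Nat.eq_zero_or_pos w with h | h
    · simp [h, show k = 0 by omega]
    · push_cast [Nat.cast_sub h]; ring
  rw [← this]
  omega

theorem maxExcess_le_iff (hd : ∀ i < n, d i < n) (B : ℕ) :
    maxExcess n d n ≤ B ↔
      ∀ X W : Finset (Fin n), X ⊆ W → EG.excess (fun i : Fin n => d i) X W ≤ B := by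
  rw [maxExcess_le_iff_forall]
  constructor
  · rintro ⟨h0, h⟩ X W hXW
    obtain ⟨p, hp, k, rfl, hex⟩ := EG.exists_threshold (fun i : Fin n => d i) hXW
    rw [Fintype.card_fin] at hp
    refine hex.trans ?_
    rw [← cntGE_eq]
    refine (thresholdExcess_le_iff p).1 ?_
    rcases hp.lt_or_eq with hp | rfl
    · exact h p hp
    -- At the threshold `n` the first set is empty and the second is everything, so the excess is
    -- the total sum, the base value of `maxExcess`.
    · rw [thresholdExcess, cntGE_of_le hd, sumGE_of_le hd]
      simpa using h0
  · intro h
    constructor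
    · have := h ∅ univ (empty_subset _)
      rw [sumGE_eq]
      simp [EG.excess] at this ⊢
      exact_mod_cast this
    · intro p _
      rw [thresholdExcess_le_iff]
      refine h _ _ fun i hi => ?_
      rw [mem_filter] at hi ⊢
      exact ⟨hi.1, (min_le_right _ _).trans hi.2⟩

/-- The sequence between `a` and `b` that is levelled at the height `t / n`, the last entries
being the first to rise to the next level. -/
def level (n : ℕ) (a b : ℕ → ℕ) (t i : ℕ) : ℕ := max (a i) (min (b i) ((t + i) / n))

/-- The sum of a levelled sequence. -/
def levelSum (n : ℕ) (a b : ℕ → ℕ) (t : ℕ) : ℕ := ∑ i ∈ range n, level n a b t i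

/-! ### Sums of levelled sequences. -/

variable {a b : ℕ → ℕ}

theorem le_level (t i : ℕ) : a i ≤ level n a b t i := le_max_left _ _

theorem level_le (hab : ∀ i < n, a i ≤ b i) (t : ℕ) {i : ℕ} (hi : i < n) :
    level n a b t i ≤ b i := max_le (hab i hi) (min_le_left _ _)

theorem level_zero {i : ℕ} (hi : i < n) : level n a b 0 i = a i := by
  rw [level, zero_add, Nat.div_eq_of_lt hi]
  simp

theorem level_top (hab : ∀ i < n, a i ≤ b i) (hb : ∀ i < n, b i < n) {i : ℕ} (hi : i < n) :
    level n a b (n * n) i = b i := by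
  have h1 : n ≤ (n * n + i) / n := by
    rw [Nat.le_div_iff_mul_le (by omega)]
    omega
  rw [level, min_eq_left ((hb i hi).le.trans h1), max_eq_right (hab i hi)]

theorem level_succ_le (t i : ℕ) :
    level n a b (t + 1) i ≤ level n a b t i + if n ∣ t + i + 1 then 1 else 0 := by
  rw [level, level, show t + 1 + i = t + i + 1 by ring, Nat.succ_div]
  split_ifs <;> omega

/-- Only an index with `n ∣ t + i + 1` can rise, and there is at most one below `n`. -/
theorem levelSum_succ_le (t : ℕ) : levelSum n a b (t + 1) ≤ levelSum n a b t + 1 := by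
  have h1 : ((range n).filter fun i => n ∣ t + i + 1).card ≤ 1 := by
    have key : ∀ i j, j < n → i ≤ j → n ∣ t + i + 1 → n ∣ t + j + 1 → i = j := by
      intro i j hj hij h h'
      have h2 := Nat.dvd_sub h' h
      have := Nat.eq_zero_of_dvd_of_lt h2 (by omega)
      omega
    refine card_le_one.2 fun i hi j hj => ?_
    rw [mem_filter, mem_range] at hi hj
    rcases le_total i j with h | h
    · exact key i j hj.1 h hi.2 hj.2
    · exact (key j i hi.1 h hj.2 hi.2).symm
  rw [card_filter] at h1
  calc levelSum n a b (t + 1)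
      ≤ ∑ i ∈ range n, (level n a b t i + if n ∣ t + i + 1 then 1 else 0) :=
        sum_le_sum fun i _ => level_succ_le t i
    _ ≤ levelSum n a b t + 1 := by
        rw [sum_add_distrib, levelSum]
        omega

/-- A discrete intermediate value argument: a sum growing by at most one per step cannot jump over
`s`. The alternatives `t = 0` and `t = n * n` are the ends of the bisection range, where the
levelled sequence is `a` or `b`. -/
theorem levelSum_eq {s t : ℕ} (hab : ∀ i < n, a i ≤ b i) (hb : ∀ i < n, b i < n)
    (ha : ∑ i ∈ range n, a i ≤ s) (hs : s ≤ ∑ i ∈ range n, b i)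
    (ht : t = 0 ∨ levelSum n a b (t - 1) < s) (ht' : t = n * n ∨ s ≤ levelSum n a b t) :
    levelSum n a b t = s := by
  have h1 : s ≤ levelSum n a b t := by
    rcases ht' with rfl | h
    · refine hs.trans_eq (sum_congr rfl fun i hi => ?_)
      rw [level_top hab hb (mem_range.1 hi)]
    · exact h
  refine le_antisymm ?_ h1
  rcases ht with rfl | h
  · refine le_trans (sum_le_sum fun i hi => ?_) ha
    rw [level_zero (mem_range.1 hi)]
  · rcases Nat.eq_zero_or_pos t with rfl | h0
    · exact absurd h (by simpa using h1)
    · have := levelSum_succ_le (n := n) (a := a) (b := b) (t - 1)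
      rw [Nat.sub_add_cancel h0] at this
      omega

/-- The least even number that the sum of a certificate may be, judging by the lower bounds. -/
def target (n : ℕ) (a : ℕ → ℕ) : ℕ := 2 * ((maxExcess n a n + 1) / 2)

/-- The answer of the algorithm, for the height `t` found by bisection. -/
def Accepts (n : ℕ) (a b : ℕ → ℕ) (t : ℕ) : Prop :=
  levelSum n a b t = target n a ∧ maxExcess n (level n a b t) n = target n a

/-! ### Soundness and completeness of the acceptance test. -/

variable {S : IntervalSeq n}

theorem maxExcess_lower_le_iff (ha : ∀ i : Fin n, a i = S.lower i) (B : ℕ) :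
    maxExcess n a n ≤ B ↔
      ∀ X W : Finset (Fin n), X ⊆ W → EG.excess S.lower X W ≤ B := by
  rw [maxExcess_le_iff fun i hi => ?_, show (fun i : Fin n => a i) = S.lower from funext ha]
  rw [ha ⟨i, hi⟩]
  exact (S.lower_le_upper _).trans_lt (S.upper_lt _)

theorem level_lt (hab : ∀ i < n, a i ≤ b i) (hb : ∀ i < n, b i < n) (t : ℕ) :
    ∀ i < n, level n a b t i < n := fun i hi => (level_le hab t hi).trans_lt (hb i hi)

/-- The total sum is among the values maximized in `maxExcess`, so being at most the sum amounts to
equality. -/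
theorem feasible_level_iff (hab : ∀ i < n, a i ≤ b i) (hb : ∀ i < n, b i < n) {s t : ℕ}
    (ht : levelSum n a b t = s) :
    EG.Feasible (fun i : Fin n => level n a b t i) ↔ maxExcess n (level n a b t) n = s := by
  have h1 : s ≤ maxExcess n (level n a b t) n := by
    have := ((maxExcess_le_iff_forall (n := n) (d := level n a b t) n).1 le_rfl).1
    rwa [sumGE_zero, ← levelSum, ht] at this
  have h2 : (∑ i : Fin n, (level n a b t i : ℤ)) = s := by
    rw [← ht, levelSum, Finset.sum_range]
    push_cast
    rfl
  rw [EG.Feasible, h2, ← maxExcess_le_iff (level_lt hab hb t)]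
  omega

theorem Accepts.isSparsestCertificate {t : ℕ} (ha : ∀ i : Fin n, a i = S.lower i)
    (hb : ∀ i : Fin n, b i = S.upper i) (h : Accepts n a b t) :
    S.IsSparsestCertificate fun i : Fin n => level n a b t i := by
  have hab : ∀ i < n, a i ≤ b i := fun i hi => by
    rw [ha ⟨i, hi⟩, hb ⟨i, hi⟩]; exact S.lower_le_upper _
  have hbn : ∀ i < n, b i < n := fun i hi => by rw [hb ⟨i, hi⟩]; exact S.upper_lt _
  refine IntervalSeq.isSparsestCertificate_of_feasible (M := maxExcess n a n)
    (fun B => (maxExcess_lower_le_iff ha B).2) ?_ (fun i => ⟨?_, ?_⟩)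
    ((feasible_level_iff hab hbn h.1).2 h.2)
  · rw [← Finset.sum_range fun i => level n a b t i]
    exact h.1
  · rw [← ha]; exact le_level t i
  · rw [← hb]; exact level_le hab t i.2

theorem accepts_of_realizable {t : ℕ} (ha : ∀ i : Fin n, a i = S.lower i)
    (hb : ∀ i : Fin n, b i = S.upper i) (hS : S.Realizable)
    (ht : t = 0 ∨ levelSum n a b (t - 1) < target n a)
    (ht' : t = n * n ∨ target n a ≤ levelSum n a b t) : Accepts n a b t := by
  have hab : ∀ i < n, a i ≤ b i := fun i hi => by
    rw [ha ⟨i, hi⟩, hb ⟨i, hi⟩]; exact S.lower_le_upper _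
  have hbn : ∀ i < n, b i < n := fun i hi => by rw [hb ⟨i, hi⟩]; exact S.upper_lt _
  have h1 : levelSum n a b t = target n a := by
    refine levelSum_eq hab hbn ?_ ?_ ht ht'
    · have := ((maxExcess_le_iff_forall (n := n) (d := a) n).1 le_rfl).1
      rw [sumGE_zero] at this
      rw [target]
      omega
    · have := hS.le_sum_upper (M := maxExcess n a n) fun B => (maxExcess_lower_le_iff ha B).2
      rw [Finset.sum_range]
      simpa only [hb, target] using this
  refine ⟨h1, (feasible_level_iff hab hbn h1).1 ?_⟩
  -- For `i < n` the unclamped height `(t + i) / n` is `t / n` or `t / n + 1`, so an entry outside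
  -- these two levels is clamped.
  refine hS.feasible (M := maxExcess n a n) (L := t / n) (maxExcess_lower_le_iff ha) ?_ ?_ ?_
  · rw [← Finset.sum_range fun i => level n a b t i]
    exact h1
  · intro i hi
    have h2 : (t + i) / n ≤ (t + n) / n := Nat.div_le_div_right (by have := i.2; omega)
    rw [Nat.add_div_right _ (Nat.zero_lt_of_lt i.2)] at h2
    rw [← ha]
    simp only [level] at hi ⊢
    omega
  · intro i hi
    have h2 : t / n ≤ (t + i) / n := Nat.div_le_div_right (by omega)
    rw [← hb]
    have := hab i i.2
    simp only [level] at hi ⊢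
    omega

end Levelling

/-! ### Reasoning about programs -/

namespace RAM

infixr:65 " ;; " => Prog.seq

instance (b : Test) (x y : ℕ) : Decidable (b.Holds x y) := by
  cases b <;> unfold Test.Holds <;> infer_instance

@[simp] theorem State.setReg_reg (σ : State) (r v s : ℕ) :
    (σ.setReg r v).reg s = if s = r then v else σ.reg s := by
  simp [State.setReg, Function.update_apply]

@[simp] theorem State.setReg_arr (σ : State) (r v : ℕ) : (σ.setReg r v).arr = σ.arr := rfl

@[simp] theorem State.setArr_reg (σ : State) (a i v : ℕ) : (σ.setArr a i v).reg = σ.reg := rfl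

@[simp] theorem State.setArr_arr (σ : State) (a i v b j : ℕ) :
    (σ.setArr a i v).arr b j = if b = a ∧ j = i then v else σ.arr b j := by
  by_cases h : b = a
  · subst h
    simp [State.setArr, Function.update_apply]
  · simp [State.setArr, h]

@[simp] theorem State.ite_reg (c : Prop) [Decidable c] (σ τ : State) (r : ℕ) :
    (if c then σ else τ).reg r = if c then σ.reg r else τ.reg r := by
  split_ifs <;> rfl

@[simp] theorem State.ite_arr (c : Prop) [Decidable c] (σ τ : State) (a i : ℕ) :
    (if c then σ else τ).arr a i = if c then σ.arr a i else τ.arr a i := by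
  split_ifs <;> rfl

/-- The final state of a program without loops. -/
def Prog.run : Prog → State → State
  | .skip, σ => σ
  | .const r c, σ => σ.setReg r c
  | .copy r s, σ => σ.setReg r (σ.reg s)
  | .arith o r s t, σ => σ.setReg r (o.eval (σ.reg s) (σ.reg t))
  | .load r a s, σ => σ.setReg r (σ.arr a (σ.reg s))
  | .store a s r, σ => σ.setArr a (σ.reg s) (σ.reg r)
  | .seq p q, σ => q.run (p.run σ)
  | .cond b s t p q, σ => if b.Holds (σ.reg s) (σ.reg t) then p.run σ else q.run σ
  | .loop _ _ _ _, σ => σ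

/-- A program has no loops, and it respects the word bound. -/
def Prog.Safe (W : ℕ) : Prog → State → Prop
  | .const _ c, _ => c < W
  | .arith o _ s t, σ => o.eval (σ.reg s) (σ.reg t) < W
  | .seq p q, σ => p.Safe W σ ∧ q.Safe W (p.run σ)
  | .cond b s t p q, σ =>
    (b.Holds (σ.reg s) (σ.reg t) → p.Safe W σ) ∧ (¬ b.Holds (σ.reg s) (σ.reg t) → q.Safe W σ)
  | .loop _ _ _ _, _ => False
  | _, _ => True

/-- A bound on the number of steps of a program without loops. -/
def Prog.size : Prog → ℕ
  | .seq p q => p.size + q.size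
  | .cond _ _ _ p q => 1 + (p.size + q.size)
  | _ => 1

/-- Whether the register `r` is the target of an instruction. -/
def Prog.writesReg (r : ℕ) : Prog → Bool
  | .const r' _ => Nat.beq r r'
  | .copy r' _ => Nat.beq r r'
  | .arith _ r' _ _ => Nat.beq r r'
  | .load r' _ _ => Nat.beq r r'
  | .seq p q => p.writesReg r || q.writesReg r
  | .cond _ _ _ p q => p.writesReg r || q.writesReg r
  | .loop _ _ _ p => p.writesReg r
  | _ => false

/-- Whether the array `a` is the target of an instruction. -/
def Prog.writesArr (a : ℕ) : Prog → Bool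
  | .store a' _ _ => Nat.beq a a'
  | .seq p q => p.writesArr a || q.writesArr a
  | .cond _ _ _ p q => p.writesArr a || q.writesArr a
  | .loop _ _ _ p => p.writesArr a
  | _ => false

/-- The states `σ` and `τ` agree on what `p` does not write. -/
structure Frame (p : Prog) (σ τ : State) : Prop where
  reg : ∀ r, p.writesReg r = false → τ.reg r = σ.reg r
  arr : ∀ a, p.writesArr a = false → τ.arr a = σ.arr a

theorem Frame.refl (p : Prog) (σ : State) : Frame p σ σ := ⟨fun _ _ => rfl, fun _ _ => rfl⟩

theorem Frame.trans {p : Prog} {σ τ υ : State} (h : Frame p σ τ) (h' : Frame p τ υ) :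
    Frame p σ υ :=
  ⟨fun r hr => (h'.reg r hr).trans (h.reg r hr), fun a ha => (h'.arr a ha).trans (h.arr a ha)⟩

theorem Frame.mono {p q : Prog} {σ τ : State} (h : Frame p σ τ)
    (hr : ∀ r, q.writesReg r = false → p.writesReg r = false)
    (ha : ∀ a, q.writesArr a = false → p.writesArr a = false) : Frame q σ τ :=
  ⟨fun r h' => h.reg r (hr r h'), fun a h' => h.arr a (ha a h')⟩

theorem frame_setReg {p : Prog} {σ : State} {r v : ℕ} (h : p.writesReg r = true) :
    Frame p σ (σ.setReg r v) := by
  refine ⟨fun s hs => ?_, fun _ _ => rfl⟩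
  rw [State.setReg_reg, if_neg]
  rintro rfl
  simp [h] at hs

/-- Invariants need only mention what a program changes; for a concrete program, preservation of the
rest is decided by evaluation. -/
theorem Exec.frame {W : ℕ} {p : Prog} {σ τ : State} {k : ℕ} (h : Exec W p σ k τ) :
    Frame p σ τ := by
  have beq_refl : ∀ r, Nat.beq r r = true := fun r => by simp
  induction h with
  | skip σ => exact Frame.refl _ _
  | const σ r c h => exact frame_setReg (beq_refl r)
  | copy σ r s => exact frame_setReg (beq_refl r)
  | arith σ o r s t h => exact frame_setReg (beq_refl r)
  | load σ r a s => exact frame_setReg (beq_refl r)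
  | store σ a s r =>
    refine ⟨fun _ _ => rfl, fun b hb => funext fun j => ?_⟩
    rw [State.setArr_arr, if_neg]
    rintro ⟨rfl, -⟩
    simp [Prog.writesArr] at hb
  | seq _ _ ihp ihq =>
    exact (ihp.mono (fun r hr => by simp_all [Prog.writesReg])
      fun a ha => by simp_all [Prog.writesArr]).trans
      (ihq.mono (fun r hr => by simp_all [Prog.writesReg])
      fun a ha => by simp_all [Prog.writesArr])
  | cond_true _ _ ih =>
    exact ih.mono (fun r hr => by simp_all [Prog.writesReg])
      fun a ha => by simp_all [Prog.writesArr]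
  | cond_false _ _ ih =>
    exact ih.mono (fun r hr => by simp_all [Prog.writesReg])
      fun a ha => by simp_all [Prog.writesArr]
  | loop_true _ _ _ ihp ihl =>
    exact Frame.trans (p := .loop _ _ _ _) (ihp.mono (fun r hr => hr) fun a ha => ha) ihl
  | loop_false _ => exact Frame.refl _ _

/-- Started in `σ`, the program halts within `K` steps in a state with the property `Q`. -/
def Run (W : ℕ) (p : Prog) (σ : State) (K : ℕ) (Q : State → Prop) : Prop :=
  ∃ k τ, Exec W p σ k τ ∧ k ≤ K ∧ Q τ

/-! ### Rules for total correctness with a step bound. -/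

variable {W : ℕ} {p q : Prog} {σ : State} {K K' : ℕ} {Q R : State → Prop}

theorem Run.mono (h : Run W p σ K Q) (hK : K ≤ K') (hQ : ∀ τ, Q τ → R τ) : Run W p σ K' R := by
  obtain ⟨k, τ, h1, h2, h3⟩ := h
  exact ⟨k, τ, h1, h2.trans hK, hQ τ h3⟩

theorem Run.seq (h : Run W p σ K Q) (h' : ∀ τ, Q τ → Frame p σ τ → Run W q τ K' R) :
    Run W (p ;; q) σ (K + K') R := by
  obtain ⟨k, τ, h1, h2, h3⟩ := h
  obtain ⟨l, υ, h4, h5, h6⟩ := h' τ h3 h1.frame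
  exact ⟨k + l, υ, .seq h1 h4, by omega, h6⟩

theorem exec_run (p : Prog) : ∀ σ, p.Safe W σ → ∃ k ≤ p.size, Exec W p σ k (p.run σ) := by
  induction p with
  | skip => exact fun σ _ => ⟨1, le_rfl, .skip σ⟩
  | const r c => exact fun σ h => ⟨1, le_rfl, .const σ r c h⟩
  | copy r s => exact fun σ _ => ⟨1, le_rfl, .copy σ r s⟩
  | arith o r s t => exact fun σ h => ⟨1, le_rfl, .arith σ o r s t h⟩
  | load r a s => exact fun σ _ => ⟨1, le_rfl, .load σ r a s⟩
  | store a s r => exact fun σ _ => ⟨1, le_rfl, .store σ a s r⟩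
  | seq p q ihp ihq =>
    intro σ h
    obtain ⟨k, hk, hp⟩ := ihp σ h.1
    obtain ⟨l, hl, hq⟩ := ihq _ h.2
    exact ⟨k + l, Nat.add_le_add hk hl, .seq hp hq⟩
  | cond b s t p q ihp ihq =>
    intro σ h
    by_cases hb : b.Holds (σ.reg s) (σ.reg t)
    · obtain ⟨k, hk, hp⟩ := ihp σ (h.1 hb)
      refine ⟨1 + k, by simp only [Prog.size]; omega, ?_⟩
      rw [Prog.run, if_pos hb]
      exact .cond_true hb hp
    · obtain ⟨k, hk, hq⟩ := ihq σ (h.2 hb)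
      refine ⟨1 + k, by simp only [Prog.size]; omega, ?_⟩
      rw [Prog.run, if_neg hb]
      exact .cond_false hb hq
  | loop => exact fun σ h => h.elim

theorem Run.straight (hs : p.Safe W σ) (hK : p.size ≤ K) (hQ : Q (p.run σ)) : Run W p σ K Q := by
  obtain ⟨k, hk, h⟩ := exec_run p σ hs
  exact ⟨k, _, h, hk.trans hK, hQ⟩

/-- Each round lowers by one the exponent of a power of two above `μ`, so a measure below `2 ^ m`
allows at most `m` rounds. -/
theorem Run.loop {b : Test} {s t : ℕ} {Inv : State → Prop} {μ : State → ℕ}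
    (hstep : ∀ τ, Inv τ → b.Holds (τ.reg s) (τ.reg t) →
      Run W p τ K fun υ => Inv υ ∧ ∀ m, μ τ < 2 ^ (m + 1) → μ υ < 2 ^ m)
    (hμ : ∀ τ, Inv τ → b.Holds (τ.reg s) (τ.reg t) → 0 < μ τ) (m : ℕ) :
    ∀ σ, Inv σ → μ σ < 2 ^ m →
      Run W (.loop b s t p) σ (m * (K + 1) + 1)
        fun υ => Inv υ ∧ ¬ b.Holds (υ.reg s) (υ.reg t) := by
  induction m with
  | zero =>
    intro σ hσ hm
    have hb : ¬ b.Holds (σ.reg s) (σ.reg t) := fun hb => by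
      have := hμ σ hσ hb
      simp at hm
      omega
    exact ⟨1, σ, .loop_false hb, by omega, hσ, hb⟩
  | succ m ih =>
    intro σ hσ hm
    by_cases hb : b.Holds (σ.reg s) (σ.reg t)
    · obtain ⟨k, τ, h1, h2, h3, h4⟩ := hstep σ hσ hb
      obtain ⟨l, υ, h5, h6, h7⟩ := ih τ h3 (h4 m hm)
      refine ⟨1 + k + l, υ, .loop_true hb h1 h5, ?_, h7⟩
      rw [Nat.succ_mul]
      omega
    · exact ⟨1, σ, .loop_false hb, by omega, hσ, hb⟩

/-- Run `p` with the register `i` counting up from `0` to the contents of `N`; the register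
`one` has to hold `1`. -/
def Prog.forLoop (i N one : ℕ) (p : Prog) : Prog :=
  .const i 0 ;; .loop .lt i N (p ;; .arith .add i i one)

/-- A round costs the body plus a test and an increment; the final `2` pays for the initialization
and the failing test. -/
theorem Run.forLoop {n i N one : ℕ} {Inv : ℕ → State → Prop}
    (hN : σ.reg N = n) (hone : σ.reg one = 1) (hn : n < W)
    (hNw : (Prog.forLoop i N one p).writesReg N = false)
    (honew : (Prog.forLoop i N one p).writesReg one = false)
    (hi : p.writesReg i = false)
    (h0 : Inv 0 (σ.setReg i 0))
    (hstep : ∀ j < n, ∀ τ, Inv j τ → τ.reg i = j → Frame (Prog.forLoop i N one p) σ τ →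
      Run W p τ K fun υ => Inv (j + 1) (υ.setReg i (j + 1))) :
    Run W (Prog.forLoop i N one p) σ (n * (K + 2) + 2) (Inv n) := by
  have hif : (Prog.forLoop i N one p).writesReg i = true := by
    simp [Prog.forLoop, Prog.writesReg]
  have key : ∀ m j τ, j + m = n → Inv j τ → τ.reg i = j →
      Frame (Prog.forLoop i N one p) σ τ →
      Run W (.loop .lt i N (p ;; .arith .add i i one)) τ (m * (K + 2) + 1) (Inv n) := by
    intro m
    induction m with
    | zero =>
      intro j τ hj hInv hij hf
      have hN' := hf.reg N hNw
      refine ⟨1, τ, .loop_false ?_, by omega, ?_⟩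
      · simp only [Test.Holds]; omega
      · rwa [show n = j by omega]
    | succ m ih =>
      intro j τ hj hInv hij hf
      obtain ⟨k, υ, h1, h2, h3⟩ := hstep j (by omega) τ hInv hij hf
      have hN' := hf.reg N hNw
      have hone' := hf.reg one honew
      have hfr := h1.frame
      have hυi := hfr.reg i hi
      have hf' : Frame (Prog.forLoop i N one p) τ υ := hfr.mono
        (fun r hr => by simp_all [Prog.forLoop, Prog.writesReg])
        (fun a ha => by simp_all [Prog.forLoop, Prog.writesArr])
      have hυone := hf'.reg one honew
      have hsum : Op.add.eval (υ.reg i) (υ.reg one) = j + 1 := by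
        simp only [Op.eval]; omega
      have h4 : Exec W (.arith .add i i one) υ 1 (υ.setReg i (j + 1)) := by
        have := Exec.arith (W := W) υ .add i i one (by rw [hsum]; omega)
        rwa [hsum] at this
      obtain ⟨l, ρ, h5, h6, h7⟩ := ih (j + 1) (υ.setReg i (j + 1)) (by omega) h3 (by simp)
        ((hf.trans hf').trans (frame_setReg hif))
      refine ⟨1 + (k + 1) + l, ρ, .loop_true ?_ (.seq h1 h4) h5, ?_, h7⟩
      · simp only [Test.Holds]; omega
      · rw [Nat.succ_mul]; omega
  obtain ⟨k, τ, h1, h2, h3⟩ := key n 0 (σ.setReg i 0) (by omega) h0 (by simp) (frame_setReg hif)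
  exact ⟨1 + k, τ, .seq (.const σ i 0 (by omega)) h1, by omega, h3⟩

end RAM

/-! ### The program

Register `1` holds `n`, and the registers `2`, `3`, `18` hold the constants `1`, `0`, `2`. -/

namespace RAM

open Finset Levelling

/-- The constants are in place, and the words are large enough. -/
structure Ready (W n : ℕ) (σ : State) : Prop where
  len : σ.reg 1 = n
  one : σ.reg 2 = 1
  zero : σ.reg 3 = 0
  two : σ.reg 18 = 2
  pos : 1 ≤ n
  bound : 4 * (n * n) + 4 * n + 4 < W

theorem Ready.of_reg {W n : ℕ} {σ τ : State} (h : Ready W n σ) (h1 : τ.reg 1 = σ.reg 1)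
    (h2 : τ.reg 2 = σ.reg 2) (h3 : τ.reg 3 = σ.reg 3) (h4 : τ.reg 18 = σ.reg 18) :
    Ready W n τ :=
  ⟨h1.trans h.len, h2.trans h.one, h3.trans h.zero, h4.trans h.two, h.pos, h.bound⟩

theorem Ready.lt {W n : ℕ} {σ : State} (h : Ready W n σ) : n < W := by
  have := h.bound
  omega

variable {W n : ℕ} {σ : State}

/-- Clear the first `n` entries of array `6`. -/
def clearProg : Prog := .forLoop 4 1 2 (.store 6 4 3)

theorem run_clearProg (h : Ready W n σ) :
    Run W clearProg σ (n * 3 + 2) fun τ => ∀ v < n, τ.arr 6 v = 0 := by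
  refine Run.forLoop (K := 1) (Inv := fun j τ => ∀ v < j, τ.arr 6 v = 0)
    h.len h.one h.lt rfl rfl rfl (by simp) fun j hj τ hInv hij hf => ?_
  have h3 := (hf.reg 3 rfl).trans h.zero
  refine Run.straight trivial le_rfl fun v hv => ?_
  simp only [Prog.run, State.setReg_arr, State.setArr_arr, hij, h3, true_and]
  split_ifs with hvj
  · rfl
  · exact hInv v (by omega)

/-- Count in array `6` how often each value occurs in array `x`. -/
def countProg (x : ℕ) : Prog :=
  .forLoop 4 1 2 (.load 5 x 4 ;; .load 6 6 5 ;; .arith .add 6 6 2 ;; .store 6 5 6)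

theorem run_countProg {x : ℕ} (h : Ready W n σ) (hx : Nat.beq x 6 = false)
    (h6 : ∀ v < n, σ.arr 6 v = 0) (hd : ∀ i < n, σ.arr x i < n) :
    Run W (countProg x) σ (n * 6 + 2) fun τ => ∀ v < n, τ.arr 6 v =
      cntEq n (σ.arr x) v := by
  refine Run.forLoop (K := 4)
    (Inv := fun j τ => ∀ v < n, τ.arr 6 v = cntEq j (σ.arr x) v)
    h.len h.one h.lt rfl rfl rfl (by simpa [cntEq_zero] using h6) fun j hj τ hInv hij hf => ?_
  have h2 := (hf.reg 2 rfl).trans h.one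
  have hx' : τ.arr x = σ.arr x := hf.arr x (by simpa [Prog.forLoop, Prog.writesArr] using hx)
  have hdj := hInv _ (hd j hj)
  have hW := h.lt
  refine Run.straight ?_ le_rfl fun v hv => ?_
  · have := cntEq_le (n := j) (d := σ.arr x) (σ.arr x j)
    simp [Prog.Safe, Prog.run, Op.eval, hij, hx', h2, hdj]
    omega
  · have := hInv v hv
    rw [cntEq_succ]
    simp [Prog.run, Op.eval, hij, hx', h2, hdj]
    rcases eq_or_ne v (σ.arr x j) with rfl | hne
    · simp
    · rw [if_neg hne, if_neg hne.symm, this, add_zero]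

/-- Turn the counts in array `6` into the numbers, and in array `7` the sums, of the entries that
are at least a given value. -/
def suffixProg : Prog :=
  .forLoop 4 1 2
    (.arith .sub 5 1 4 ;; .arith .sub 6 5 2 ;; .load 7 6 6 ;; .load 8 6 5 ;; .arith .mul 9 6 7 ;;
      .arith .add 8 8 7 ;; .store 6 6 8 ;; .load 8 7 5 ;; .arith .add 8 8 9 ;; .store 7 6 8)

/-- The recursions `cntGE_eq_add` and `sumGE_eq_add` are run from the top value down, in place for
the counts: entries below `n - j` are still raw counts. The zeros at index `n` start both
recursions. -/
theorem run_suffixProg {d : ℕ → ℕ} (h : Ready W n σ) (hd : ∀ i < n, d i < n)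
    (h6 : ∀ v < n, σ.arr 6 v = cntEq n d v)
    (h6n : σ.arr 6 n = 0) (h7n : σ.arr 7 n = 0) :
    Run W suffixProg σ (n * 12 + 2) fun τ =>
      ∀ v ≤ n, τ.arr 6 v = cntGE n d v ∧ τ.arr 7 v = sumGE n d v := by
  refine Run.mono (Run.forLoop (K := 10)
    (Inv := fun j τ => (∀ v ≤ n, n - j ≤ v → τ.arr 6 v = cntGE n d v ∧ τ.arr 7 v = sumGE n d v) ∧
      ∀ v < n - j, τ.arr 6 v = cntEq n d v)
    h.len h.one h.lt rfl rfl rfl ?_ fun j hj τ hInv hij hf => ?_) le_rfl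
    fun τ hτ v hv => hτ.1 v hv (by omega)
  · refine ⟨fun v hv hv' => ?_, fun v hv => h6 v hv⟩
    obtain rfl : v = n := by omega
    simp [h6n, h7n, cntGE_of_le hd, sumGE_of_le hd]
  · obtain ⟨hInv1, hInv2⟩ := hInv
    have h1 := (hf.reg 1 rfl).trans h.len
    have h2 := (hf.reg 2 rfl).trans h.one
    obtain ⟨u, hu⟩ : ∃ u, n - j = u + 1 := ⟨n - j - 1, by omega⟩
    have hu' : n - (j + 1) = u := by omega
    have hc := hInv2 u (by omega)
    obtain ⟨hc1, hs1⟩ := hInv1 (u + 1) (by omega) (by omega)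
    have hcu := cntGE_eq_add (n := n) (d := d) u
    have hsu := sumGE_eq_add (n := n) (d := d) u
    have hcle := cntGE_le (n := n) (d := d) u
    have hsle := sumGE_le hd u
    have hW := h.bound
    refine Run.straight ?_ le_rfl ⟨fun v hv hv' => ?_, fun v hv => ?_⟩
    · simp [Prog.Safe, Prog.run, Op.eval, hij, h1, h2, hu, hc, hc1, hs1]
      refine ⟨?_, ?_, ?_, ?_, ?_⟩ <;> omega
    · rw [hu'] at hv'
      have := hInv1 v hv
      simp [Prog.run, Op.eval, hij, h1, h2, hu, hc, hc1, hs1]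
      rcases hv'.eq_or_lt with rfl | hlt
      · simp
        omega
      · rw [if_neg (by omega), if_neg (by omega)]
        exact this (by omega)
    · rw [hu'] at hv
      have := hInv2 v (by omega)
      simp [Prog.run, Op.eval, hij, h1, h2, hu, hc, hc1, hs1]
      rw [if_neg (by omega)]
      exact this

/-- Compute in register `10` the largest excess of a threshold set. -/
def maxProg : Prog :=
  .load 10 7 3 ;;
    .forLoop 4 1 2
      (.load 5 6 4 ;; .cond .lt 5 4 (.copy 6 5) (.copy 6 4) ;; .load 7 6 6 ;; .load 8 7 6 ;;
        .load 9 7 4 ;; .arith .add 8 9 8 ;; .arith .sub 7 7 2 ;; .arith .mul 7 5 7 ;;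
        .arith .sub 8 8 7 ;; .cond .lt 10 8 (.copy 10 8) .skip)

theorem run_maxProg {d : ℕ → ℕ} (h : Ready W n σ) (hd : ∀ i < n, d i < n)
    (h67 : ∀ v ≤ n, σ.arr 6 v = cntGE n d v ∧ σ.arr 7 v = sumGE n d v) :
    Run W maxProg σ (1 + (n * 16 + 2)) fun τ => τ.reg 10 = maxExcess n d n := by
  refine Run.seq (Q := fun τ => τ = σ.setReg 10 (sumGE n d 0)) (Run.straight trivial le_rfl ?_)
    fun υ hυ _ => ?_
  · simp [Prog.run, h.zero, (h67 0 (by omega)).2]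
  subst hυ
  refine Run.forLoop (K := 14) (Inv := fun j τ => τ.reg 10 = maxExcess n d j)
    (by simp [h.len]) (by simp [h.one]) h.lt rfl rfl rfl (by simp [maxExcess])
    fun j hj τ hInv hij hf => ?_
  have h2 : τ.reg 2 = 1 := (hf.reg 2 rfl).trans (by simp [h.one])
  have h6 : τ.arr 6 = σ.arr 6 := hf.arr 6 rfl
  have h7 : τ.arr 7 = σ.arr 7 := hf.arr 7 rfl
  obtain ⟨hk, hg⟩ := h67 j hj.le
  have hmin : (if cntGE n d j < j then cntGE n d j else j) = min (cntGE n d j) j := by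
    split_ifs <;> omega
  obtain ⟨hw, hgm⟩ := h67 (min (cntGE n d j) j) ((min_le_right _ _).trans hj.le)
  have b1 := cntGE_le (n := n) (d := d) j
  have b2 := cntGE_le (n := n) (d := d) (min (cntGE n d j) j)
  have b3 := sumGE_le hd j
  have b4 := sumGE_le hd (min (cntGE n d j) j)
  have b5 : cntGE n d j * (cntGE n d (min (cntGE n d j) j) - 1) ≤ n * n :=
    Nat.mul_le_mul b1 (by omega)
  have hW := h.bound
  refine Run.straight ?_ le_rfl ?_
  · simp [Prog.Safe, Prog.run, Op.eval, Test.Holds, hij, h2, h6, h7, hk, hg, hmin, hw, hgm]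
    omega
  · simp [Prog.run, Op.eval, Test.Holds, hij, h2, h6, h7, hk, hg, hmin, hw, hgm, hInv, maxExcess,
      thresholdExcess]
    split_ifs <;> omega

/-- Compute in register `10` the largest excess for the sequence in array `x`. -/
def maxExcessProg (x : ℕ) : Prog :=
  clearProg ;; countProg x ;; (.store 6 1 3 ;; .store 7 1 3) ;; suffixProg ;; maxProg

theorem run_maxExcessProg {x : ℕ} (h : Ready W n σ) (hx : Nat.beq x 6 = false)
    (hd : ∀ i < n, σ.arr x i < n) :
    Run W (maxExcessProg x) σ (48 * n) fun τ => τ.reg 10 = maxExcess n (σ.arr x) n := by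
  have hn := h.pos
  refine Run.mono (Run.seq (run_clearProg h) fun τ hτ f1 => ?_)
    -- This is `37 * n + 11`, at most `48 * n` because `n` is positive.
    (K := n * 3 + 2 + (n * 6 + 2 + (2 + (n * 12 + 2 + (1 + (n * 16 + 2))))))
    (by omega) fun τ hτ => hτ
  have h1 : Ready W n τ := h.of_reg (f1.reg 1 rfl) (f1.reg 2 rfl) (f1.reg 3 rfl) (f1.reg 18 rfl)
  have hx1 : τ.arr x = σ.arr x :=
    f1.arr x (by simpa [clearProg, Prog.forLoop, Prog.writesArr] using hx)
  refine Run.seq (run_countProg h1 hx hτ (by rwa [hx1])) fun υ hυ f2 => ?_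
  rw [hx1] at hυ
  have h2 : Ready W n υ := h1.of_reg (f2.reg 1 rfl) (f2.reg 2 rfl) (f2.reg 3 rfl) (f2.reg 18 rfl)
  refine Run.seq (Q := fun ρ => ρ = (υ.setArr 6 n 0).setArr 7 n 0)
    (Run.straight ⟨trivial, trivial⟩ le_rfl ?_) fun ρ hρ _ => ?_
  · simp [Prog.run, h2.len, h2.zero]
  subst hρ
  set ρ := (υ.setArr 6 n 0).setArr 7 n 0 with hρ
  have h3 : Ready W n ρ := h2.of_reg rfl rfl rfl rfl
  refine Run.seq (run_suffixProg h3 hd (fun v hv => ?_) ?_ ?_) fun π hπ f4 => ?_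
  · simp [hρ, hυ v hv, hv.ne]
  · simp [hρ]
  · simp [hρ]
  · exact run_maxProg (h3.of_reg (f4.reg 1 rfl) (f4.reg 2 rfl) (f4.reg 3 rfl) (f4.reg 18 rfl)) hd hπ

/-- Store in array `5` the sequence between the arrays `0` and `1` that is levelled at the height
given in register `14`, and in register `15` its sum. -/
def levelProg : Prog :=
  .copy 15 3 ;;
    .forLoop 4 1 2
      (.arith .add 5 14 4 ;; .arith .div 5 5 1 ;; .load 6 1 4 ;; .cond .lt 6 5 (.copy 5 6) .skip ;;
        .load 6 0 4 ;; .cond .lt 5 6 (.copy 5 6) .skip ;; .store 5 4 5 ;; .arith .add 15 15 5)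

theorem run_levelProg (h : Ready W n σ) (hab : ∀ i < n, σ.arr 0 i ≤ σ.arr 1 i)
    (hb : ∀ i < n, σ.arr 1 i < n) (ht : σ.reg 14 ≤ n * n) :
    Run W levelProg σ (17 * n) fun τ =>
      τ.reg 15 = levelSum n (σ.arr 0) (σ.arr 1) (σ.reg 14) ∧
        ∀ i < n, τ.arr 5 i = level n (σ.arr 0) (σ.arr 1) (σ.reg 14) i := by
  have hn := h.pos
  set a := σ.arr 0 with ha
  set b := σ.arr 1 with hb'
  set t := σ.reg 14 with ht'
  refine Run.mono (Run.seq (Q := fun τ => τ = σ.setReg 15 0) (Run.straight trivial le_rfl ?_)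
    fun υ hυ _ => ?_) (K := 1 + (n * 14 + 2)) (by omega) fun τ hτ => hτ
  · simp [Prog.run, h.zero]
  subst hυ
  refine Run.forLoop (K := 12)
    (Inv := fun j τ => τ.reg 15 = ∑ i ∈ range j, level n a b t i ∧
      ∀ i < j, τ.arr 5 i = level n a b t i)
    (by simp [h.len]) (by simp [h.one]) h.lt rfl rfl rfl (by simp)
    fun j hj τ hInv hij hf => ?_
  obtain ⟨hInv1, hInv2⟩ := hInv
  have h1 : τ.reg 1 = n := (hf.reg 1 rfl).trans (by simp [h.len])
  have h14 : τ.reg 14 = t := (hf.reg 14 rfl).trans (by simp [ht'])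
  have h0a : τ.arr 0 = a := hf.arr 0 rfl
  have h1b : τ.arr 1 = b := hf.arr 1 rfl
  have hlev : (if (if b j < (t + j) / n then b j else (t + j) / n) < a j then a j
      else if b j < (t + j) / n then b j else (t + j) / n) = level n a b t j := by
    rw [level]
    split_ifs <;> omega
  have hsum : ∑ i ∈ range j, level n a b t i + level n a b t j ≤ n * n := by
    rw [← sum_range_succ]
    refine (sum_le_card_nsmul _ _ n fun i hi => ?_).trans ?_
    · rw [mem_range] at hi
      exact (level_lt hab hb t i (by omega)).le
    · rw [card_range, smul_eq_mul]
      exact Nat.mul_le_mul_right n hj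
  have hW := h.bound
  have hdiv : (t + j) / n ≤ t + j := Nat.div_le_self _ _
  refine Run.straight ?_ le_rfl ⟨?_, fun i hi => ?_⟩
  · simp [Prog.Safe, Prog.run, Op.eval, Test.Holds, hij, h1, h14, h0a, h1b, hInv1, hlev]
    omega
  · simp [Prog.run, Op.eval, Test.Holds, hij, h1, h14, h0a, h1b, hInv1, hlev, sum_range_succ]
  · simp [Prog.run, Op.eval, Test.Holds, hij, h1, h14, h0a, h1b, hlev]
    split_ifs with hi'
    · rw [hi']
    · exact hInv2 i (by omega)

/-- Find by bisection in the register `12` the least height at which the levelled sequence has at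
least the sum given in register `11`. -/
def bisectProg : Prog :=
  (.copy 12 3 ;; .arith .mul 13 1 1) ;;
    .loop .lt 12 13
      ((.arith .add 14 12 13 ;; .arith .div 14 14 18) ;; levelProg ;;
        .cond .lt 15 11 (.arith .add 12 14 2) (.copy 13 14))

/-- The invariant only keeps a crossing of `s` between the two ends, so monotonicity of `levelSum`
in the height is not needed. -/
theorem run_bisectProg {s : ℕ} (h : Ready W n σ) (hab : ∀ i < n, σ.arr 0 i ≤ σ.arr 1 i)
    (hb : ∀ i < n, σ.arr 1 i < n) (hs : σ.reg 11 = s) :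
    Run W bisectProg σ (49 * (n * (Nat.log 2 n + 1))) fun τ =>
      τ.reg 12 ≤ n * n ∧
      (τ.reg 12 = 0 ∨ levelSum n (σ.arr 0) (σ.arr 1) (τ.reg 12 - 1) < s) ∧
      (τ.reg 12 = n * n ∨ s ≤ levelSum n (σ.arr 0) (σ.arr 1) (τ.reg 12)) := by
  have hn := h.pos
  set a := σ.arr 0 with ha
  set b := σ.arr 1 with hb'
  set l := Nat.log 2 n + 1 with hl
  have hW := h.bound
  have hnl : n < 2 ^ l := Nat.lt_pow_succ_log_self (by norm_num) n
  have hl1 : 1 ≤ l := by omega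
  refine Run.mono (Run.seq (Q := fun τ => τ = (σ.setReg 12 0).setReg 13 (n * n))
    (K := 2) (Run.straight ?_ le_rfl ?_) fun υ hυ _ => ?_)
    (K := 2 + ((2 * l) * (22 * n + 1) + 1)) (by nlinarith) fun τ hτ => hτ
  · simp [Prog.Safe, Prog.run, Op.eval, h.len]
    omega
  · simp [Prog.run, Op.eval, h.zero, h.len]
  subst hυ
  refine Run.mono (Run.loop
    (Inv := fun τ => (Ready W n τ ∧ τ.arr 0 = a ∧ τ.arr 1 = b ∧ τ.reg 11 = s) ∧
      τ.reg 12 ≤ τ.reg 13 ∧ τ.reg 13 ≤ n * n ∧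
      (τ.reg 12 = 0 ∨ levelSum n a b (τ.reg 12 - 1) < s) ∧
      (τ.reg 13 = n * n ∨ s ≤ levelSum n a b (τ.reg 13)))
    (μ := fun τ => τ.reg 13 - τ.reg 12) (K := 22 * n) ?_ ?_ (2 * l) _ ?_ ?_) le_rfl ?_
  · rintro τ ⟨⟨hr, h0, h1, h11⟩, hle, hhi, hlo, hup⟩ hlt
    simp only [Test.Holds] at hlt
    set lo := τ.reg 12 with hlo'
    set hi := τ.reg 13 with hhi'
    set mid := (lo + hi) / 2 with hmid
    refine Run.mono (K := 2 + (17 * n + 3)) (Run.seq (Q := fun ρ => ρ = τ.setReg 14 mid)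
      (K := 2) ?_ fun ρ hρ _ => ?_) (by omega) fun τ hτ => hτ
    · refine Run.straight ?_ le_rfl ?_
      · simp [Prog.Safe, Prog.run, Op.eval, ← hlo', ← hhi', hr.two]
        omega
      · have : ∀ v, (τ.setReg 14 v).setReg 14 mid = τ.setReg 14 mid := fun v => by
          simp [State.setReg]
        simp [Prog.run, Op.eval, ← hlo', ← hhi', hr.two, ← hmid, this]
    subst hρ
    refine Run.seq (run_levelProg (σ := τ.setReg 14 mid) (hr.of_reg rfl rfl rfl rfl)
      (by simpa [h0, h1] using hab) (by simpa [h1] using hb) (by simp; omega)) fun π hπ f => ?_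
    have e15 := hπ.1
    have e11 : π.reg 11 = s := (f.reg 11 rfl).trans (by simp [h11])
    have e12 : π.reg 12 = lo := (f.reg 12 rfl).trans (by simp [hlo'])
    have e13 : π.reg 13 = hi := (f.reg 13 rfl).trans (by simp [hhi'])
    have e14 : π.reg 14 = mid := (f.reg 14 rfl).trans (by simp)
    have e2 : π.reg 2 = 1 := (f.reg 2 rfl).trans (by simp [hr.one])
    have e0 : π.arr 0 = a := (f.arr 0 rfl).trans h0
    have e1 : π.arr 1 = b := (f.arr 1 rfl).trans h1
    have hr' : Ready W n π := hr.of_reg (f.reg 1 rfl) (f.reg 2 rfl) (f.reg 3 rfl) (f.reg 18 rfl)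
    simp only [State.setReg_arr, h0, h1, State.setReg_reg, if_true] at e15
    refine Run.straight ?_ le_rfl ?_
    · simp [Prog.Safe, Op.eval, Test.Holds, e14, e2]
      omega
    · by_cases hc : levelSum n a b mid < s
      · have hrun : Prog.run (.cond .lt 15 11 (.arith .add 12 14 2) (.copy 13 14)) π =
            π.setReg 12 (mid + 1) := by
          simp [Prog.run, Op.eval, Test.Holds, e14, e2, e15, e11, hc]
        rw [hrun]
        refine ⟨⟨⟨hr'.of_reg rfl rfl rfl rfl, e0, e1, by simp [e11]⟩, ?_⟩, fun m hm => ?_⟩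
        · simp only [State.setReg_reg]
          simp [e13, hc, hhi, hup]
          omega
        · rw [pow_succ] at hm
          simp [e13]
          omega
      · have hrun : Prog.run (.cond .lt 15 11 (.arith .add 12 14 2) (.copy 13 14)) π =
            π.setReg 13 mid := by
          simp [Prog.run, Test.Holds, e14, e15, e11, hc]
        rw [hrun]
        refine ⟨⟨⟨hr'.of_reg rfl rfl rfl rfl, e0, e1, by simp [e11]⟩, ?_⟩, fun m hm => ?_⟩
        · simp [e12, hlo, not_lt.1 hc]
          omega
        · rw [pow_succ] at hm
          simp [e12]
          omega
  · rintro τ - hlt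
    simp only [Test.Holds] at hlt
    omega
  · exact ⟨⟨h.of_reg rfl rfl rfl rfl, rfl, rfl, by simp [hs]⟩, by simp⟩
  -- The initial range `n * n` is below `2 ^ (2 * l)`, since `n < 2 ^ l`.
  · rw [two_mul, pow_add]
    simpa using Nat.mul_lt_mul'' hnl hnl
  · rintro τ ⟨⟨-, hle, hhi, hlo, hup⟩, hnlt⟩
    simp only [Test.Holds] at hnlt
    have : τ.reg 13 = τ.reg 12 := by omega
    rw [this] at hhi hup
    exact ⟨hhi, hlo, hup⟩

/-- Leave in array `5` a certificate of a sparsest graph for the intervals in the arrays `0` and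
`1`, and in register `16` whether there is one. -/
def solveProg : Prog :=
  maxExcessProg 0 ;; (.arith .add 11 10 2 ;; .arith .div 11 11 18 ;; .arith .mul 11 11 18) ;;
    bisectProg ;; .copy 14 12 ;; levelProg ;; maxExcessProg 5 ;;
      .copy 16 3 ;; .cond .eq 15 11 (.cond .eq 10 11 (.copy 16 2) .skip) .skip

theorem run_solveProg {S : IntervalSeq n} (h : Ready W n σ)
    (ha : ∀ i : Fin n, σ.arr 0 i = S.lower i) (hb : ∀ i : Fin n, σ.arr 1 i = S.upper i) :
    Run W solveProg σ (172 * (n * (Nat.log 2 n + 1))) fun τ =>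
      (S.Realizable → τ.reg 16 = 1 ∧ S.IsSparsestCertificate fun i => τ.arr 5 i) ∧
        (¬ S.Realizable → τ.reg 16 = 0) := by
  have hn := h.pos
  have hW := h.bound
  have hab' : ∀ i < n, σ.arr 0 i ≤ σ.arr 1 i := fun i hi => by
    rw [ha ⟨i, hi⟩, hb ⟨i, hi⟩]; exact S.lower_le_upper _
  have hbn' : ∀ i < n, σ.arr 1 i < n := fun i hi => by rw [hb ⟨i, hi⟩]; exact S.upper_lt _
  -- Any crossing height decides realizability, whichever one the bisection returns.
  have key : ∀ t, (t = 0 ∨ levelSum n (σ.arr 0) (σ.arr 1) (t - 1) < target n (σ.arr 0)) →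
      (t = n * n ∨ target n (σ.arr 0) ≤ levelSum n (σ.arr 0) (σ.arr 1) t) →
      (S.Realizable ↔ Accepts n (σ.arr 0) (σ.arr 1) t) := fun t h1 h2 =>
    ⟨fun hS => accepts_of_realizable ha hb hS h1 h2,
      fun hA => ⟨_, (hA.isSparsestCertificate ha hb).isCertificate⟩⟩
  have hspars : ∀ t, Accepts n (σ.arr 0) (σ.arr 1) t →
      S.IsSparsestCertificate fun i : Fin n => level n (σ.arr 0) (σ.arr 1) t i :=
    fun t hA => hA.isSparsestCertificate ha hb
  set a := σ.arr 0 with hadef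
  set b := σ.arr 1 with hbdef
  set l := n * (Nat.log 2 n + 1) with hl
  have hnl : n ≤ l := Nat.le_mul_of_pos_right n (by omega)
  have han' : ∀ i < n, a i < n := fun i hi => (hab' i hi).trans_lt (hbn' i hi)
  refine Run.mono (Run.seq (run_maxExcessProg (x := 0) h rfl han') fun τ hτ f1 => ?_)
    (K := 48 * n + (3 + (49 * l + (1 + (17 * n + (48 * n + (1 + 5)))))))
    (by omega) fun τ hτ => hτ
  have h1 : Ready W n τ := h.of_reg (f1.reg 1 rfl) (f1.reg 2 rfl) (f1.reg 3 rfl) (f1.reg 18 rfl)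
  have a1 : τ.arr 0 = a := f1.arr 0 rfl
  have b1 : τ.arr 1 = b := f1.arr 1 rfl
  have hM := maxExcess_le han' n
  rw [← hadef] at hτ
  refine Run.seq (Q := fun υ => υ.reg 11 = target n a) (Run.straight ?_ le_rfl ?_)
    fun υ hυ f2 => ?_
  · simp [Prog.Safe, Prog.run, Op.eval, h1.one, h1.two, hτ]
    omega
  · simp [Prog.run, Op.eval, h1.one, h1.two, hτ, target]
    omega
  have h2 : Ready W n υ := h1.of_reg (f2.reg 1 rfl) (f2.reg 2 rfl) (f2.reg 3 rfl) (f2.reg 18 rfl)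
  have a2 : υ.arr 0 = a := (f2.arr 0 rfl).trans a1
  have b2 : υ.arr 1 = b := (f2.arr 1 rfl).trans b1
  refine Run.seq (run_bisectProg h2 (by rwa [a2, b2]) (by rwa [b2]) hυ) fun π hπ f3 => ?_
  rw [a2, b2] at hπ
  obtain ⟨ht, hlo, hup⟩ := hπ
  set t := π.reg 12 with htdef
  have h3 : Ready W n π := h2.of_reg (f3.reg 1 rfl) (f3.reg 2 rfl) (f3.reg 3 rfl) (f3.reg 18 rfl)
  have a3 : π.arr 0 = a := (f3.arr 0 rfl).trans a2
  have b3 : π.arr 1 = b := (f3.arr 1 rfl).trans b2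
  have s3 : π.reg 11 = target n a := (f3.reg 11 rfl).trans hυ
  rw [key t hlo hup]
  refine Run.seq (Q := fun ρ => ρ = π.setReg 14 t) (Run.straight trivial le_rfl rfl)
    fun ρ hρ _ => ?_
  subst hρ
  have h4 : Ready W n (π.setReg 14 t) := h3.of_reg rfl rfl rfl rfl
  refine Run.seq (run_levelProg h4 (by simpa [a3, b3] using hab') (by simpa [b3] using hbn')
    (by simpa using ht)) fun κ hκ f5 => ?_
  simp only [State.setReg_arr, a3, b3, State.setReg_reg, if_true] at hκ
  obtain ⟨hS, hD⟩ := hκ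
  have h5 : Ready W n κ := h4.of_reg (f5.reg 1 rfl) (f5.reg 2 rfl) (f5.reg 3 rfl) (f5.reg 18 rfl)
  have s5 : κ.reg 11 = target n a := (f5.reg 11 rfl).trans (by simp [s3])
  refine Run.seq (run_maxExcessProg (x := 5) h5 rfl fun i hi => ?_) fun ω hω f6 => ?_
  · rw [hD i hi]; exact level_lt hab' hbn' t i hi
  have h6 : Ready W n ω := h5.of_reg (f6.reg 1 rfl) (f6.reg 2 rfl) (f6.reg 3 rfl) (f6.reg 18 rfl)
  have s6 : ω.reg 11 = target n a := (f6.reg 11 rfl).trans s5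
  have S6 : ω.reg 15 = levelSum n a b t := (f6.reg 15 rfl).trans hS
  have D6 : ω.arr 5 = κ.arr 5 := f6.arr 5 rfl
  rw [maxExcess_congr hD] at hω
  refine Run.straight (by simp [Prog.Safe]) le_rfl ⟨fun hA => ⟨?_, ?_⟩, fun hA => ?_⟩
  · simp [Prog.run, Test.Holds, h6.zero, h6.one, s6, S6, hω, hA.1, hA.2]
  · have := hspars t hA
    convert this using 2 with i
    rw [← hD i i.2, ← D6]
    simp [Prog.run]
  · simp only [Accepts, not_and] at hA
    simp [Prog.run, Test.Holds, h6.zero, h6.one, s6, S6, hω]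
    exact hA

/-- Copy array `5` to the arrays `2` and `3`, and complement the intervals in the arrays `0` and
`1`. -/
def complProg : Prog :=
  .forLoop 4 1 2
    (.load 5 5 4 ;; .store 2 4 5 ;; .store 3 4 5 ;; .load 5 0 4 ;; .load 6 1 4 ;;
      .arith .sub 5 19 5 ;; .arith .sub 6 19 6 ;; .store 1 4 5 ;; .store 0 4 6)

/-- Both ends of an interval are loaded before either is overwritten, so the exchange is done in
place; the second half of the invariant protects the intervals still to come. -/
theorem run_complProg (h : Ready W n σ) (h19 : σ.reg 19 = n - 1) :
    Run W complProg σ (n * 11 + 2) fun τ => ∀ i < n,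
      τ.arr 2 i = σ.arr 5 i ∧ τ.arr 3 i = σ.arr 5 i ∧
        τ.arr 0 i = n - 1 - σ.arr 1 i ∧ τ.arr 1 i = n - 1 - σ.arr 0 i := by
  have hW := h.lt
  refine Run.mono (Run.forLoop (K := 9)
    (Inv := fun j τ => (∀ i < j, τ.arr 2 i = σ.arr 5 i ∧ τ.arr 3 i = σ.arr 5 i ∧
        τ.arr 0 i = n - 1 - σ.arr 1 i ∧ τ.arr 1 i = n - 1 - σ.arr 0 i) ∧
      ∀ i, j ≤ i → τ.arr 0 i = σ.arr 0 i ∧ τ.arr 1 i = σ.arr 1 i)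
    h.len h.one h.lt rfl rfl rfl (by simp) fun j hj τ hInv hij hf => ?_) le_rfl fun τ hτ => hτ.1
  obtain ⟨hdone, hrest⟩ := hInv
  have e19 : τ.reg 19 = n - 1 := (hf.reg 19 rfl).trans h19
  have e5 : τ.arr 5 = σ.arr 5 := hf.arr 5 rfl
  obtain ⟨e0, e1⟩ := hrest j le_rfl
  refine Run.straight ?_ le_rfl ⟨fun i hi => ?_, fun i hi => ?_⟩
  · simp [Prog.Safe, Prog.run, Op.eval, hij, e19, e5, e0, e1]
    omega
  · rcases Nat.lt_succ_iff_lt_or_eq.1 hi with hlt | rfl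
    · simpa [Prog.run, Op.eval, hij, hlt.ne] using hdone i hlt
    · simp [Prog.run, Op.eval, hij, e19, e5, e0, e1]
  · have hne : i ≠ j := by omega
    simpa [Prog.run, Op.eval, hij, hne] using hrest i (by omega)

/-- Store the complement of the sequence in array `5` in array `4`. -/
def outputProg : Prog :=
  .forLoop 4 1 2 (.load 5 5 4 ;; .arith .sub 5 19 5 ;; .store 4 4 5)

theorem run_outputProg (h : Ready W n σ) (h19 : σ.reg 19 = n - 1) :
    Run W outputProg σ (n * 5 + 2) fun τ => ∀ i < n, τ.arr 4 i = n - 1 - σ.arr 5 i := by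
  have hW := h.lt
  refine Run.forLoop (K := 3) (Inv := fun j τ => ∀ i < j, τ.arr 4 i = n - 1 - σ.arr 5 i)
    h.len h.one h.lt rfl rfl rfl (by simp) fun j hj τ hInv hij hf => ?_
  have e19 : τ.reg 19 = n - 1 := (hf.reg 19 rfl).trans h19
  have e5 : τ.arr 5 = σ.arr 5 := hf.arr 5 rfl
  refine Run.straight ?_ le_rfl fun i hi => ?_
  · simp [Prog.Safe, Prog.run, Op.eval, hij, e19, e5]
    omega
  · rcases Nat.lt_succ_iff_lt_or_eq.1 hi with hlt | rfl
    · simpa [Prog.run, Op.eval, hij, hlt.ne] using hInv i hlt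
    · simp [Prog.run, Op.eval, hij, e19, e5]

/-- The whole algorithm. -/
def mainProg : Prog :=
  (.copy 1 0 ;; .const 2 1 ;; .const 3 0 ;; .const 18 2) ;; solveProg ;;
    (.copy 17 16 ;; .arith .sub 19 1 2) ;; complProg ;; solveProg ;; outputProg ;; .copy 0 17

/-- The second run of `solveProg` works on the complementary intervals, and its sequence
complemented is a densest certificate. The verdict comes from the first run, whose flag is saved in
register `17`. -/
theorem run_mainProg (hn : 1 ≤ n) (hW : 4 * (n * n) + 4 * n + 4 < W) (S : IntervalSeq n) :
    Run W mainProg (input S) (400 * (n * (Nat.log 2 n + 1))) fun τ =>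
      (S.Realizable →
        τ.reg 0 = 1 ∧
        S.IsCertificate (τ.read n 2) ∧
        S.IsSparsestCertificate (τ.read n 3) ∧
        S.IsDensestCertificate (τ.read n 4)) ∧
      (¬ S.Realizable → τ.reg 0 = 0) := by
  set l := n * (Nat.log 2 n + 1) with hl
  have hnl : n ≤ l := Nat.le_mul_of_pos_right n (by omega)
  refine Run.mono (Run.seq (Q := fun τ => Ready W n τ) (K := 4) (Run.straight ?_ le_rfl ?_)
    fun τ h1 f1 => ?_)
    (K := 4 + (172 * l + (2 + ((n * 11 + 2) + (172 * l + ((n * 5 + 2) + 1))))))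
    (by omega) fun τ hτ => hτ
  · simp [Prog.Safe]
    omega
  · refine ⟨?_, ?_, ?_, ?_, hn, hW⟩ <;> simp [Prog.run, input]
  have a1 : ∀ i : Fin n, τ.arr 0 i = S.lower i := fun i => by
    rw [f1.arr 0 rfl]; simp [input]
  have b1 : ∀ i : Fin n, τ.arr 1 i = S.upper i := fun i => by
    rw [f1.arr 1 rfl]; simp [input]
  refine Run.seq (run_solveProg h1 a1 b1) fun υ hυ f2 => ?_
  have h2 : Ready W n υ := h1.of_reg (f2.reg 1 rfl) (f2.reg 2 rfl) (f2.reg 3 rfl) (f2.reg 18 rfl)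
  refine Run.seq (Q := fun ρ => ρ = (υ.setReg 17 (υ.reg 16)).setReg 19 (n - 1))
    (Run.straight ?_ le_rfl ?_) fun ρ hρ _ => ?_
  · simp [Prog.Safe, Prog.run, Op.eval, h2.len, h2.one]
    omega
  · simp [Prog.run, Op.eval, h2.len, h2.one]
  have h3 : Ready W n ρ := by rw [hρ]; exact h2.of_reg rfl rfl rfl rfl
  have e17 : ρ.reg 17 = υ.reg 16 := by simp [hρ]
  have e19 : ρ.reg 19 = n - 1 := by simp [hρ]
  have earr : ρ.arr = υ.arr := by rw [hρ]; rfl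
  refine Run.seq (run_complProg h3 e19) fun κ hκ f4 => ?_
  have h4 : Ready W n κ := h3.of_reg (f4.reg 1 rfl) (f4.reg 2 rfl) (f4.reg 3 rfl) (f4.reg 18 rfl)
  rw [earr] at hκ
  refine Run.seq (run_solveProg (S := S.compl) h4 (fun i => ?_) fun i => ?_) fun π hπ f5 => ?_
  · rw [(hκ i i.2).2.2.1, f2.arr 1 rfl, b1]; rfl
  · rw [(hκ i i.2).2.2.2, f2.arr 0 rfl, a1]; rfl
  have h5 : Ready W n π := h4.of_reg (f5.reg 1 rfl) (f5.reg 2 rfl) (f5.reg 3 rfl) (f5.reg 18 rfl)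
  refine Run.seq (run_outputProg h5 (((f5.reg 19 rfl).trans (f4.reg 19 rfl)).trans e19))
    fun ω hω f6 => ?_
  have e17' : ω.reg 17 = υ.reg 16 :=
    (((f6.reg 17 rfl).trans (f5.reg 17 rfl)).trans (f4.reg 17 rfl)).trans e17
  have hread2 : ω.read n 2 = fun i : Fin n => υ.arr 5 i := funext fun i => by
    rw [State.read, f6.arr 2 rfl, f5.arr 2 rfl, (hκ i i.2).1]
  have hread3 : ω.read n 3 = fun i : Fin n => υ.arr 5 i := funext fun i => by
    rw [State.read, f6.arr 3 rfl, f5.arr 3 rfl, (hκ i i.2).2.1]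
  have hread4 : ω.read n 4 = fun i : Fin n => n - 1 - π.arr 5 i := funext fun i => by
    rw [State.read, hω i i.2]
  refine Run.straight trivial le_rfl ⟨fun hS => ?_, fun hS => ?_⟩
  · obtain ⟨h16, hsp⟩ := hυ.1 hS
    refine ⟨by simp [Prog.run, e17', h16], ?_, ?_, ?_⟩
    · exact hread2 ▸ hsp.isCertificate
    · exact hread3 ▸ hsp
    · exact hread4 ▸ (hπ.1 hS.compl).2.compl
  · simp [Prog.run, e17', hυ.2 hS]

theorem isBigO_mul_log_add_one (C : ℕ) :
    (fun n : ℕ => ((C * (n * (Nat.log 2 n + 1)) : ℕ) : ℝ)) =O[Filter.atTop]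
      fun n : ℕ => (n : ℝ) * Real.log (n : ℝ) := by
  -- For `n ≥ 2` both `Nat.log 2 n` and `1` are at most `log n / log 2`, hence the factor two.
  refine Asymptotics.IsBigO.of_bound (C * (2 / Real.log 2)) ?_
  filter_upwards [Filter.eventually_ge_atTop 2] with n hn
  have h2 : 0 < Real.log 2 := Real.log_pos one_lt_two
  have hn' : (2 : ℝ) ≤ n := by exact_mod_cast hn
  have h3 : Real.log 2 ≤ Real.log n := Real.log_le_log two_pos hn'
  have h4 : (Nat.log 2 n : ℝ) ≤ Real.log n / Real.log 2 := by
    rw [le_div_iff₀ h2, ← Real.log_pow]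
    refine Real.log_le_log (by positivity) ?_
    exact_mod_cast Nat.pow_log_le_self 2 (by omega)
  have h5 : 1 ≤ Real.log n / Real.log 2 := by rwa [le_div_iff₀ h2, one_mul]
  rw [Real.norm_of_nonneg (by positivity),
    Real.norm_of_nonneg (mul_nonneg (by positivity) (h2.le.trans h3))]
  push_cast
  calc (C : ℝ) * (n * (Nat.log 2 n + 1))
      ≤ C * (n * (Real.log n / Real.log 2 + Real.log n / Real.log 2)) := by gcongr
    _ = C * (2 / Real.log 2) * (n * Real.log n) := by ring

end RAM

theorem theorem1 :
    ∃ (P : RAM.Prog) (c : ℕ) (T : ℕ → ℕ),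
      ((fun n : ℕ => (T n : ℝ)) =O[Filter.atTop] fun n : ℕ => (n : ℝ) * Real.log (n : ℝ)) ∧
      ∀ (n : ℕ), 1 ≤ n → ∀ S : IntervalSeq n,
        ∃ (k : ℕ) (τ : RAM.State),
          RAM.Exec ((n + 1) ^ c) P (RAM.input S) k τ ∧ k ≤ T n ∧
          (S.Realizable →
            τ.reg 0 = 1 ∧
            S.IsCertificate (τ.read n 2) ∧
            S.IsSparsestCertificate (τ.read n 3) ∧
            S.IsDensestCertificate (τ.read n 4)) ∧
          (¬ S.Realizable → τ.reg 0 = 0) := by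
  refine ⟨RAM.mainProg, 4, fun n => 400 * (n * (Nat.log 2 n + 1)),
    RAM.isBigO_mul_log_add_one 400, fun n hn S => RAM.run_mainProg hn ?_ S⟩
  -- The word bound must exceed `4 * (n * n) + 4 * n + 4`; at `n = 1` this is `12`, so the exponent
  -- `3` would be too small.
  have h1 : 4 ≤ (n + 1) ^ 2 := by nlinarith
  have h2 : (n + 1) ^ 4 = (n + 1) ^ 2 * (n + 1) ^ 2 := by ring
  rw [h2]
  nlinarith
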